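/- Let $m=2u\ge 4$ be even, $n=2^m-1$, $r=2^u+1$, and let $\alpha$ be a primitive element of $\mathbb F_{2^m}$. Let $H_m=[\alpha^0,\alpha^1,\dots,\alpha^{n-1}]$ and $E_m=[\alpha^{0},\alpha^{r},\dots,\alpha^{(n-1)r}]$, read as binary matrices; $H_m$ is a parity check matrix of the Hamming code $\mathcal H_m\subset\mathbb F_2^n$. Let $C^{(u)}=\{v\in\mathbb F_2^n: H_mv^T=0,\ E_mv^T=0\}$. Write $\alpha^j=\gamma_{j1}+\gamma_{j2}\alpha$ with $\gamma_{j1},\gamma_{j2}\in\mathbb F_{2^u}$, and put $S(v)=\sum_{j:\,v_j\ne 0}\gamma_{j1}\gamma_{j2}$. Choose $v_1,\dots,v_u\in\mathcal H_m$ with $S(v_1),\dots,S(v_u)$ linearly independent over $\mathbb F_2$, and for $0\le i\le u$ put $C^{(i)}=\langle C^{(u)},v_1,\dots,v_{u-i}\rangle$. Let $C^{(i)*}\subset\mathbb F_2^{n+1}$ be the code $C^{(i)}$ extended by an overall parity check position, and let $\Gamma^{(i)*}$ be its coset graph: the vertices are the cosets of $C^{(i)*}$ in $\mathbb F_2^{n+1}$,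 two different cosets being adjacent if and only if they contain vectors at Hamming distance $1$. A connected graph $\Gamma$ of diameter $D\ge 3$ is called antipodal if the graph $\Gamma_D$ of pairs of vertices at distance $D$ is a disjoint union of cliques. A graph $\Gamma$ covers $\Gamma'$ with fibre size $k\geq 1$ via a map $f$ of the vertex sets if $f$ maps the neighbours of each vertex $x$ bijectively onto the neighbours of $f(x)$ and all fibres of $f$ have $k$ elements. Such $v_1,\dots,v_u$ exist, and for every choice of them: 1. For $0\le i\le u$ the graph $\Gamma^{(i)*}$ has $2^{m+i+1}$ vertices. 2. For $1\le i\le u$ the graph $\Gamma^{(i)*}$ is an antipodal distance-regular graph of diameter $4$ with intersection array $$(2^m,\ 2^m-1,\ 2^m-2^{m-i},\ 1;\ 1,\ 2^{m-i},\ 2^m-1,\ 2^m).$$ The graph $\Gamma^{(0)*}$ is isomorphic to the complete bipartite graph $K_{2^m,2^m}$, which is distance-regular of diameter $2$ with intersection array $(2^m,2^m-1;\,1,2^m)$. 3. The family is nested: for $0\le j<i\le u$ we have $C^{(i)*}\subsetneq C^{(j)*}$, and via the natural map $C^{(i)*}+x\mapsto C^{(j)*}+x$ the graph $\Gamma^{(i)*}$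 covers $\Gamma^{(j)*}$ with fibre size $2^{i-j}$; any two different vertices in the same fibre are at distance $4$ in $\Gamma^{(i)*}$. 4. $\Gamma^{(i)*}$ is distance-transitive for $i\in\{0,1,u\}$, and, when $m=6$, for all $0\le i\le 3$. -/

import Mathlib

/-! ### Graphs -/

namespace CosetGraphs

/-- `Γ_k`: same vertices as `G`, two distinct vertices being adjacent when their distance in `G`
is `k`. -/
def distanceGraph {V : Type*} (G : SimpleGraph V) (k : ℕ) : SimpleGraph V where
  Adj x y := x ≠ y ∧ G.dist x y = k
  symm := ⟨fun _ _ h => ⟨h.1.symm, by rw [SimpleGraph.dist_comm]; exact h.2⟩⟩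
  loopless := ⟨fun _ h => h.1 rfl⟩

/-- A connected graph of diameter `D ≥ 3` is antipodal if `Γ_D` is a disjoint union of cliques,
i.e. any two distinct vertices in the same connected component of `Γ_D` are adjacent in `Γ_D`. -/
structure IsAntipodal {V : Type*} (G : SimpleGraph V) : Prop where
  connected : G.Connected
  three_le_diam : 3 ≤ G.diam
  cliques : ∀ x y : V, (distanceGraph G G.diam).Reachable x y → x ≠ y →
    (distanceGraph G G.diam).Adj x y

/-- `G` is distance-regular with intersection array `(b₀, …, b_{D-1}; c₁, …, c_D)`, given as the
lists `b = [b₀, …, b_{D-1}]` and `c = [c₁, …, c_D]`, where `D` is the diameter.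
(By convention `b_D = 0` and `c₀ = 0`.) -/
structure IsDistanceRegular {V : Type*} (G : SimpleGraph V) (b c : List ℕ) : Prop where
  connected : G.Connected
  diam_eq : G.diam = b.length
  length_eq : c.length = b.length
  regular : ∀ x : V, (G.neighborSet x).ncard = b.getD 0 0
  outward : ∀ x y : V, {z | G.Adj y z ∧ G.dist x z = G.dist x y + 1}.ncard =
    b.getD (G.dist x y) 0
  inward : ∀ x y : V, {z | G.Adj y z ∧ G.dist x z + 1 = G.dist x y}.ncard =
    (0 :: c).getD (G.dist x y) 0

/-- Connected, and the automorphism group is transitive on the ordered pairs of vertices at each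
given distance. -/
structure IsDistanceTransitive {V : Type*} (G : SimpleGraph V) : Prop where
  connected : G.Connected
  transitive : ∀ x y x' y' : V, G.dist x y = G.dist x' y' → ∃ φ : G ≃g G, φ x = x' ∧ φ y = y'

/-- `f` is an `r`-fold covering of the graph `H` by the graph `G`: it maps the neighbours of every
vertex `x` bijectively onto the neighbours of `f x`, and all its fibres have size `r ≥ 1`. -/
structure IsCover {V W : Type*} (G : SimpleGraph V) (H : SimpleGraph W) (f : V → W) (r : ℕ) :
    Prop where
  pos : 0 < r
  bijOn : ∀ x : V, Set.BijOn f (G.neighborSet x) (H.neighborSet (f x))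
  fibre : ∀ w : W, (f ⁻¹' {w}).ncard = r

/-! ### Codes -/

/-- The coset graph of a binary linear code: the vertices are the cosets, two different cosets
being adjacent if and only if they contain vectors at Hamming distance one. -/
def cosetGraph {k : ℕ} (C : Submodule (ZMod 2) (Fin k → ZMod 2)) :
    SimpleGraph ((Fin k → ZMod 2) ⧸ C) where
  Adj B B' := B ≠ B' ∧ ∃ v v' : Fin k → ZMod 2,
    Submodule.Quotient.mk v = B ∧ Submodule.Quotient.mk v' = B' ∧ hammingDist v v' = 1
  symm := ⟨fun _ _ h => by
    obtain ⟨hne, v, v', hv, hv', hd⟩ := h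
    exact ⟨hne.symm, v', v, hv', hv, by rw [hammingDist_comm]; exact hd⟩⟩
  loopless := ⟨fun _ h => h.1 rfl⟩

/-- The extended code: an overall parity check coordinate is put in front (position `0`). -/
def extendedCode {k : ℕ} (C : Submodule (ZMod 2) (Fin k → ZMod 2)) :
    Submodule (ZMod 2) (Fin (k + 1) → ZMod 2) where
  carrier := {y | (fun j : Fin k => y j.succ) ∈ C ∧ y 0 = ∑ j : Fin k, y j.succ}
  add_mem' := by
    rintro x y ⟨hx, hx'⟩ ⟨hy, hy'⟩
    refine ⟨C.add_mem hx hy, ?_⟩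
    simp only [Pi.add_apply, Finset.sum_add_distrib, hx', hy']
  zero_mem' := ⟨C.zero_mem, by simp⟩
  smul_mem' := by
    rintro a x ⟨hx, hx'⟩
    refine ⟨C.smul_mem a hx, ?_⟩
    simp only [Pi.smul_apply, ← Finset.smul_sum, hx']

section Field

variable {F : Type*} [Field F]

/-! In what follows `F` is the field with `q²` elements, `q = 2^u`, and `α ∈ F` is primitive. Every
`x ∈ F` is uniquely `x = γ₁ + γ₂ α` with `γ₁, γ₂` in the subfield `𝔽_q = {γ | γ^q = γ}`, see
`coord_spec`. -/

/-- The coordinate `γ₂`. -/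
def coordTwo (u : ℕ) (α x : F) : F := (x - x ^ 2 ^ u) / (α - α ^ 2 ^ u)

/-- The coordinate `γ₁`. -/
def coordOne (u : ℕ) (α x : F) : F := x - coordTwo u α x * α

variable [Algebra (ZMod 2) F]

theorem coord_spec (u : ℕ) (hF : Nat.card F = 2 ^ (2 * u)) (α : F) (hα : α ^ 2 ^ u ≠ α) (x : F) :
    coordOne u α x + coordTwo u α x * α = x ∧
      coordOne u α x ^ 2 ^ u = coordOne u α x ∧ coordTwo u α x ^ 2 ^ u = coordTwo u α x := by
  have : CharP F 2 := charP_of_injective_algebraMap (algebraMap (ZMod 2) F).injective 2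
  have : Finite F := Nat.finite_of_card_ne_zero (by rw [hF]; positivity)
  have : Fintype F := Fintype.ofFinite F
  have hpow : ∀ y : F, (y ^ 2 ^ u) ^ 2 ^ u = y := by
    intro y
    rw [← pow_mul, ← pow_add, ← two_mul, ← hF, Nat.card_eq_fintype_card, FiniteField.pow_card]
  have hne : α - α ^ 2 ^ u ≠ 0 := sub_ne_zero.mpr (Ne.symm hα)
  have h2 : coordTwo u α x ^ 2 ^ u = coordTwo u α x := by
    unfold coordTwo
    rw [div_pow, sub_pow_char_pow, sub_pow_char_pow, hpow, hpow, ← neg_sub x, ← neg_sub α,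
      neg_div_neg_eq]
  refine ⟨by simp [coordOne], ?_, h2⟩
  have h3 : coordTwo u α x * (α - α ^ 2 ^ u) = x - x ^ 2 ^ u := by
    unfold coordTwo
    field_simp
  unfold coordOne
  rw [sub_pow_char_pow, mul_pow, h2]
  linear_combination h3

/-- `v ↦ H_m vᵀ`, where `H_m = [α⁰, α¹, …, α^{n-1}]` and `n = 2^{2u} - 1`. -/
def syndromeH (u : ℕ) (α : F) : (Fin (2 ^ (2 * u) - 1) → ZMod 2) →ₗ[ZMod 2] F :=
  Fintype.linearCombination (ZMod 2) (fun j : Fin (2 ^ (2 * u) - 1) => α ^ (j : ℕ))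

/-- `v ↦ E_m vᵀ`, where `E_m = [α^{0r}, α^r, …, α^{(n-1)r}]` and `r = 2^u + 1`. -/
def syndromeE (u : ℕ) (α : F) : (Fin (2 ^ (2 * u) - 1) → ZMod 2) →ₗ[ZMod 2] F :=
  Fintype.linearCombination (ZMod 2)
    (fun j : Fin (2 ^ (2 * u) - 1) => α ^ ((j : ℕ) * (2 ^ u + 1)))

/-- `S(v) = ∑_{j ∈ supp v} γ_{j1} γ_{j2}`, where `α^j = γ_{j1} + γ_{j2} α`. -/
def syndromeS (u : ℕ) (α : F) : (Fin (2 ^ (2 * u) - 1) → ZMod 2) →ₗ[ZMod 2] F :=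
  Fintype.linearCombination (ZMod 2)
    (fun j : Fin (2 ^ (2 * u) - 1) =>
      coordOne u α (α ^ (j : ℕ)) * coordTwo u α (α ^ (j : ℕ)))

/-- The binary Hamming code, with parity check matrix `H_m`. -/
def hammingCode (u : ℕ) (α : F) : Submodule (ZMod 2) (Fin (2 ^ (2 * u) - 1) → ZMod 2) :=
  LinearMap.ker (syndromeH u α)

/-- The code `C^{(u)}`, whose parity check matrix is the vertical join of `H_m` and `E_m`. -/
def baseCode (u : ℕ) (α : F) : Submodule (ZMod 2) (Fin (2 ^ (2 * u) - 1) → ZMod 2) :=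
  LinearMap.ker (syndromeH u α) ⊓ LinearMap.ker (syndromeE u α)

/-- The data from which a chain of codes is built: vectors `v_1, …, v_u` of the Hamming code whose
syndromes `S(v_1), …, S(v_u)` are linearly independent over `𝔽_2`. -/
structure IsGeneratingFamily (u : ℕ) (α : F)
    (v : Fin u → (Fin (2 ^ (2 * u) - 1) → ZMod 2)) : Prop where
  mem_hamming : ∀ k, v k ∈ hammingCode u α
  linearIndependent : LinearIndependent (ZMod 2) (fun k => syndromeS u α (v k))

/-- The code `C^{(i)} = ⟨C^{(u)}, v_1, …, v_{u-i}⟩`, `0 ≤ i ≤ u`. -/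
def nestedCode (u : ℕ) (α : F) (v : Fin u → (Fin (2 ^ (2 * u) - 1) → ZMod 2)) (i : ℕ) :
    Submodule (ZMod 2) (Fin (2 ^ (2 * u) - 1) → ZMod 2) :=
  baseCode u α ⊔ Submodule.span (ZMod 2) (v '' {k : Fin u | (k : ℕ) + i < u})

/-- The extended code `C^{(i)*}`. -/
abbrev nestedCodeStar (u : ℕ) (α : F) (v : Fin u → (Fin (2 ^ (2 * u) - 1) → ZMod 2)) (i : ℕ) :
    Submodule (ZMod 2) (Fin (2 ^ (2 * u) - 1 + 1) → ZMod 2) :=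
  extendedCode (nestedCode u α v i)

/-- The graph `Γ^{(i)*}`, the coset graph of `C^{(i)*}`. -/
abbrev GammaStar (u : ℕ) (α : F) (v : Fin u → (Fin (2 ^ (2 * u) - 1) → ZMod 2)) (i : ℕ) :
    SimpleGraph ((Fin (2 ^ (2 * u) - 1 + 1) → ZMod 2) ⧸ nestedCodeStar u α v i) :=
  cosetGraph (nestedCodeStar u α v i)

end Field

end CosetGraphs

namespace CosetGraphs

/-! ### Transport along isomorphisms -/

/-! Let `K` be the subfield of order `q = 2^u`, so that `F = K ⊕ Kα`. For `x = γ₁ + γ₂α` the norm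
`x^(q+1)` is `γ₁² + Tr(α)γ₁γ₂ + N(α)γ₂²`. On the Hamming code the coordinate sums vanish, hence so
do the sums of squares, and the `E`-syndrome is the nonzero trace of `α` times `S` (`syndromeE_eq`).
Let `W` be the span of `S(v_1), …, S(v_{u-i})` and `T = K/W`, of order `2^i`, with quotient map `π`.
The extended code is then the kernel of the syndrome map with columns `(1, z, π(z₁z₂))`, one for
each `z ∈ K²`, the parity position supplying `z = 0` (`nestedCodeStar_eq_ker`). So the coset graph
is the Cayley graph on `𝔽₂ × K² × T` whose connection set is this paraboloid (`cosetGraphIso`).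

There distances are explicit (`paraDist`, `dist_paraGraph`). The polar form `B(z, w) = z₁w₂ + w₁z₂`
is nondegenerate, so for `z ≠ 0` the homomorphism `w ↦ π(B(z, w))` is onto, and its fibre size
`q²/|T| = 2^(2u-i)` is the one intersection number that is not immediate (`ncard_near`). Distance 4
means differing in the `T`-coordinate alone, whence antipodality. Enlarging `W` replaces `T` by a
quotient while the neighbours stay indexed by `K²`, whence the coverings. For trivial `T` the graph
is complete bipartite.

Translations reduce distance-transitivity to the stabiliser of the origin. Additive maps preserving
the paraboloid are always transitive at distances 1 and 2 (`movable_odd`, `movable_even`). Distances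
3 and 4 need maps of `K × K` inducing a transitive action on `T \ {0}` (`Twistable`): scalars do
this for `W = 0`, nothing is needed for `|T| = 2`, and a rescaled Frobenius works for `q = 8`, `|T|
= 4`. -/

theorem edist_hom_le {V W : Type*} {G : SimpleGraph V} {H : SimpleGraph W} (φ : G →g H)
    (x y : V) : H.edist (φ x) (φ y) ≤ G.edist x y :=
  le_iInf fun w => (SimpleGraph.edist_le (w.map φ)).trans (by simp)

theorem edist_iso_apply {V W : Type*} {G : SimpleGraph V} {H : SimpleGraph W} (φ : G ≃g H)
    (x y : V) : H.edist (φ x) (φ y) = G.edist x y := by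
  refine le_antisymm (edist_hom_le φ.toHom x y) ?_
  simpa using edist_hom_le φ.symm.toHom (φ x) (φ y)

theorem dist_iso_apply {V W : Type*} {G : SimpleGraph V} {H : SimpleGraph W} (φ : G ≃g H)
    (x y : V) : H.dist (φ x) (φ y) = G.dist x y := by
  simp [SimpleGraph.dist, edist_iso_apply φ]

/-! ### Distances from a potential -/

/-- A function that vanishes exactly at `x`, changes by at most one along edges and can be decreased
by moving to a neighbour is the distance from `x`. -/
theorem reachable_and_dist_eq_of_potential {V : Type*} (G : SimpleGraph V) (x : V) (f : V → ℕ)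
    (hx : f x = 0) (h0 : ∀ y, f y = 0 → y = x) (lip : ∀ y z, G.Adj y z → f z ≤ f y + 1)
    (desc : ∀ y, f y ≠ 0 → ∃ z, G.Adj z y ∧ f z + 1 = f y) (y : V) :
    G.Reachable x y ∧ G.dist x y = f y := by
  have hwalk : ∀ (a b : V) (w : G.Walk a b), f b ≤ f a + w.length := by
    intro a b w
    induction w with
    | nil => simp
    | cons h p ih =>
      have := lip _ _ h
      simp only [SimpleGraph.Walk.length_cons]
      omega
  have hex : ∀ n y, f y = n → ∃ w : G.Walk x y, w.length = n := by
    intro n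
    induction n with
    | zero =>
      intro y hy
      obtain rfl := h0 y hy
      exact ⟨SimpleGraph.Walk.nil, rfl⟩
    | succ n ih =>
      intro y hy
      obtain ⟨z, hz, hzy⟩ := desc y (by omega)
      obtain ⟨w, hw⟩ := ih z (by omega)
      exact ⟨w.concat hz, by rw [SimpleGraph.Walk.length_concat, hw]⟩
  obtain ⟨w, hw⟩ := hex _ y rfl
  refine ⟨w.reachable, le_antisymm (hw ▸ SimpleGraph.dist_le w) ?_⟩
  obtain ⟨w', hw'⟩ := w.reachable.exists_walk_length_eq_dist
  have := hwalk _ _ w'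
  omega

/-- Finiteness and connectedness exclude an infinite extended diameter, for which `diam` would take
the junk value 0. -/
theorem diam_eq_of_dist {V : Type*} [Finite V] (G : SimpleGraph V) (hG : G.Connected) (D : ℕ)
    (hle : ∀ x y, G.dist x y ≤ D) (hex : ∃ x y, G.dist x y = D) : G.diam = D := by
  have := hG.nonempty
  obtain ⟨x, y, hxy⟩ := hex
  obtain ⟨x', y', h'⟩ := G.exists_dist_eq_diam
  refine le_antisymm (h' ▸ hle x' y') (hxy ▸ SimpleGraph.dist_le_diam ?_)
  exact SimpleGraph.connected_iff_ediam_ne_top.mp hG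

/-! ### The model graph -/

/-- Nondegeneracy of the polar form of `(x, y) ↦ x y`. -/
theorem mul_swap_surjective {K : Type*} [Field K] {z : K × K} (hz : z ≠ 0) (k : K) :
    ∃ w : K × K, z.1 * w.2 + w.1 * z.2 = k := by
  by_cases h1 : z.1 = 0
  · have h2 : z.2 ≠ 0 := fun h2 => hz (Prod.ext h1 h2)
    exact ⟨(k / z.2, 0), by simp [div_mul_cancel₀ k h2]⟩
  · exact ⟨(0, k / z.1), by simp [mul_div_cancel₀ k h1]⟩

section Model

variable {K T : Type*} [Field K] [Algebra (ZMod 2) K] [AddCommGroup T] [Module (ZMod 2) T]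

/-- The point of the paraboloid `t = π (x y)` above `z = (x, y)`. -/
def paraPoint (π : K →ₗ[ZMod 2] T) (z : K × K) : ZMod 2 × (K × K) × T := (1, z, π (z.1 * z.2))

theorem self_add_add {M : Type*} [AddCommGroup M] [Module (ZMod 2) M] (x y : M) :
    x + (x + y) = y := by
  rw [← add_assoc, ZModModule.add_self, zero_add]

theorem add_add_self {M : Type*} [AddCommGroup M] [Module (ZMod 2) M] (x y : M) :
    x + y + y = x := by
  rw [add_assoc, ZModModule.add_self, add_zero]

theorem add_eq_zero_iff_eq_of_zmod {M : Type*} [AddCommGroup M] [Module (ZMod 2) M] (x y : M) :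
    x + y = 0 ↔ x = y := by
  rw [← ZModModule.sub_eq_add, sub_eq_zero]

theorem zmod_two_cases (a : ZMod 2) : a = 0 ∨ a = 1 := by
  revert a; decide

/-- The Cayley graph on `𝔽₂ × K² × T` whose connection set is the paraboloid `t = π (x y)`. -/
def paraGraph (π : K →ₗ[ZMod 2] T) : SimpleGraph (ZMod 2 × (K × K) × T) where
  Adj p q := ∃ z, q = p + paraPoint π z
  symm := ⟨by
    rintro p _ ⟨z, rfl⟩
    exact ⟨z, (add_add_self _ _).symm⟩⟩
  loopless := ⟨by
    rintro p ⟨z, hz⟩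
    exact one_ne_zero (congrArg Prod.fst (left_eq_add.mp hz))⟩

theorem paraPoint_injective (π : K →ₗ[ZMod 2] T) : Function.Injective (paraPoint π) :=
  fun _ _ h => congrArg (fun p => p.2.1) h

theorem paraGraph_adj_add_iff (π : K →ₗ[ZMod 2] T) (p q r : ZMod 2 × (K × K) × T) :
    (paraGraph π).Adj (p + r) (q + r) ↔ (paraGraph π).Adj p q := by
  simp only [paraGraph, add_right_comm p r, add_left_inj]

/-- Translation by `r`. -/
def paraGraphTranslation (π : K →ₗ[ZMod 2] T) (r : ZMod 2 × (K × K) × T) :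
    paraGraph π ≃g paraGraph π where
  toEquiv := Equiv.addRight r
  map_rel_iff' := paraGraph_adj_add_iff π _ _ r

open scoped Classical in
/-- The distance from the origin in `paraGraph π`. -/
noncomputable def paraDist (π : K →ₗ[ZMod 2] T) (p : ZMod 2 × (K × K) × T) : ℕ :=
  if p.1 = 0 then if p.2.1 = 0 then if p.2.2 = 0 then 0 else 4 else 2
  else if p.2.2 = π (p.2.1.1 * p.2.1.2) then 1 else 3

/-! ### The distance from the origin, computed explicitly -/

section paraDist

variable (π : K →ₗ[ZMod 2] T)

theorem paraDist_zero : paraDist π 0 = 0 := by simp [paraDist]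

theorem paraDist_top {t : T} (ht : t ≠ 0) : paraDist π (0, 0, t) = 4 := by simp [paraDist, ht]

theorem paraDist_even {z : K × K} (hz : z ≠ 0) (t : T) : paraDist π (0, z, t) = 2 := by
  simp [paraDist, hz]

theorem paraDist_paraPoint (z : K × K) : paraDist π (paraPoint π z) = 1 := by
  simp [paraDist, paraPoint]

theorem paraDist_odd {z : K × K} {t : T} (h : t ≠ π (z.1 * z.2)) : paraDist π (1, z, t) = 3 := by
  simp [paraDist, h]

/-- The five alternatives are the spheres of radius 0, 1, 2, 3, 4, in this order; most later
arguments split along them. -/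
theorem paraDist_cases (p : ZMod 2 × (K × K) × T) :
    p = 0 ∨ (∃ z, p = paraPoint π z) ∨ (∃ z t, z ≠ 0 ∧ p = (0, z, t)) ∨
      (∃ z t, t ≠ π (z.1 * z.2) ∧ p = (1, z, t)) ∨ ∃ t, t ≠ 0 ∧ p = (0, 0, t) := by
  obtain ⟨a, z, t⟩ := p
  rcases zmod_two_cases a with rfl | rfl
  · by_cases hz : z = 0
    · subst hz
      by_cases ht : t = 0
      · exact Or.inl (by rw [ht]; rfl)
      · exact Or.inr (Or.inr (Or.inr (Or.inr ⟨t, ht, rfl⟩)))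
    · exact Or.inr (Or.inr (Or.inl ⟨z, t, hz, rfl⟩))
  · by_cases ht : t = π (z.1 * z.2)
    · exact Or.inr (Or.inl ⟨z, by rw [ht]; rfl⟩)
    · exact Or.inr (Or.inr (Or.inr (Or.inl ⟨z, t, ht, rfl⟩)))

theorem paraDist_le_four (p : ZMod 2 × (K × K) × T) : paraDist π p ≤ 4 := by
  unfold paraDist
  split_ifs <;> omega

theorem paraDist_eq_zero {p : ZMod 2 × (K × K) × T} (h : paraDist π p = 0) : p = 0 := by
  rcases paraDist_cases π p with rfl | ⟨z, rfl⟩ | ⟨z, t, hz, rfl⟩ | ⟨z, t, hz, rfl⟩ | ⟨t, ht, rfl⟩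
  · rfl
  · simp [paraDist_paraPoint] at h
  · simp [paraDist_even π hz] at h
  · simp [paraDist_odd π hz] at h
  · simp [paraDist_top π ht] at h

theorem even_add_paraPoint (z w : K × K) (t : T) :
    ((0, z, t) : ZMod 2 × (K × K) × T) + paraPoint π w = (1, z + w, t + π (w.1 * w.2)) := by
  simp [paraPoint]

theorem odd_add_paraPoint (z w : K × K) (t : T) :
    ((1, z, t) : ZMod 2 × (K × K) × T) + paraPoint π w = (0, z + w, t + π (w.1 * w.2)) := by
  simp only [paraPoint, Prod.mk_add_mk, ZModModule.add_self]

theorem paraDist_one (z : K × K) (t : T) [Decidable (t = π (z.1 * z.2))] :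
    paraDist π (1, z, t) = if t = π (z.1 * z.2) then 1 else 3 := by
  simp [paraDist]

/-- When the neighbour of `(0, z, t)` given by `w` lies on the paraboloid. -/
theorem eq_add_apply_mul_iff (z w : K × K) (t : T) :
    t + π (w.1 * w.2) = π ((z + w).1 * (z + w).2) ↔
      π (z.1 * w.2 + w.1 * z.2) = t + π (z.1 * z.2) := by
  have e : (z + w).1 * (z + w).2 = z.1 * z.2 + (z.1 * w.2 + w.1 * z.2) + w.1 * w.2 := by
    simp only [Prod.fst_add, Prod.snd_add]; ring
  rw [e, map_add π _ (w.1 * w.2), add_left_inj, map_add]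
  constructor
  · intro h
    rw [h, add_right_comm, ZModModule.add_self, zero_add]
  · intro h
    rw [h, add_left_comm, ZModModule.add_self, add_zero]

/-- Since 4 is the maximum, only radii below 3 need an argument. Two distinct points of the
paraboloid differ in `z`, so their sum is at distance 2. -/
theorem paraDist_add_paraPoint_le (p : ZMod 2 × (K × K) × T) (w : K × K) :
    paraDist π (p + paraPoint π w) ≤ paraDist π p + 1 := by
  classical
  rcases paraDist_cases π p with rfl | ⟨z, rfl⟩ | ⟨z, t, hz, rfl⟩ | ⟨z, t, hz, rfl⟩ | ⟨t, ht, rfl⟩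
  · rw [zero_add, paraDist_zero, paraDist_paraPoint]
  · rw [paraDist_paraPoint]
    nth_rewrite 1 [paraPoint]
    rw [odd_add_paraPoint]
    by_cases h : z = w
    · subst h
      simp only [ZModModule.add_self]
      exact (paraDist_zero π).le.trans (by omega)
    · rw [paraDist_even]
      rwa [Ne, add_eq_zero_iff_eq_of_zmod]
  · rw [even_add_paraPoint, paraDist_one, paraDist_even π hz]
    split_ifs <;> omega
  · rw [paraDist_odd π hz]
    exact paraDist_le_four π _
  · rw [paraDist_top π ht]
    exact (paraDist_le_four π _).trans (by omega)

variable {π}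

theorem exists_paraDist_add_paraPoint (hπ : Function.Surjective π) (p : ZMod 2 × (K × K) × T)
    (hp : paraDist π p ≠ 0) : ∃ w, paraDist π (p + paraPoint π w) + 1 = paraDist π p := by
  rcases paraDist_cases π p with rfl | ⟨z, rfl⟩ | ⟨z, t, hz, rfl⟩ | ⟨z, t, hz, rfl⟩ | ⟨t, ht, rfl⟩
  · exact absurd (paraDist_zero π) hp
  · refine ⟨z, ?_⟩
    rw [ZModModule.add_self, paraDist_zero, paraDist_paraPoint]
  -- Only at radius 2 is descent an equation for `w`, solvable because `π` is onto and the polar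
  -- form is nondegenerate. At radius 3 any `w ≠ z` works, at radius 4 any `w`.
  · obtain ⟨k, hk⟩ := hπ (t + π (z.1 * z.2))
    obtain ⟨w, hw⟩ := mul_swap_surjective hz k
    refine ⟨w, ?_⟩
    rw [even_add_paraPoint, (eq_add_apply_mul_iff π z w t).mpr (by rw [hw, hk]), paraDist_even π hz]
    exact congrArg (· + 1) (paraDist_paraPoint π (z + w))
  · refine ⟨z + (1, 0), ?_⟩
    rw [odd_add_paraPoint, self_add_add, paraDist_even, paraDist_odd π hz]
    exact fun h => one_ne_zero (congrArg Prod.fst h)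
  · refine ⟨0, ?_⟩
    rw [even_add_paraPoint, paraDist_odd, paraDist_top π ht]
    simpa using ht

theorem reachable_and_dist_zero (hπ : Function.Surjective π) (p : ZMod 2 × (K × K) × T) :
    (paraGraph π).Reachable 0 p ∧ (paraGraph π).dist 0 p = paraDist π p := by
  refine reachable_and_dist_eq_of_potential _ 0 (paraDist π) (paraDist_zero π)
    (fun _ => paraDist_eq_zero π) ?_ ?_ p
  · rintro p _ ⟨w, rfl⟩
    exact paraDist_add_paraPoint_le π p w
  · intro p hp
    obtain ⟨w, hw⟩ := exists_paraDist_add_paraPoint hπ p hp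
    exact ⟨_, ⟨w, (add_add_self _ _).symm⟩, hw⟩

theorem connected_paraGraph (hπ : Function.Surjective π) : (paraGraph π).Connected := by
  refine SimpleGraph.connected_iff_exists_forall_reachable _ |>.mpr ⟨0, fun p => ?_⟩
  exact (reachable_and_dist_zero hπ p).1

/-- Translation invariance; `p + q` is the difference in characteristic 2. -/
theorem dist_paraGraph (hπ : Function.Surjective π) (p q : ZMod 2 × (K × K) × T) :
    (paraGraph π).dist p q = paraDist π (p + q) := by
  have h := dist_iso_apply (paraGraphTranslation π p) p q
  rw [← h, add_comm p q, ← (reachable_and_dist_zero hπ (q + p)).2]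
  congr 1
  exact ZModModule.add_self p

end paraDist

end Model

/-! ### The intersection array of the model graph -/

/-- Fibres of a surjective homomorphism are cosets of its kernel. The product form avoids division
of naturals. -/
theorem ncard_preimage_singleton_mul_card {A B : Type*} [AddCommGroup A] [AddCommGroup B]
    (f : A →+ B) (hf : Function.Surjective f) (b : B) :
    (f ⁻¹' {b}).ncard * Nat.card B = Nat.card A := by
  obtain ⟨a, rfl⟩ := hf b
  have h1 : f ⁻¹' {f a} = (fun x => x + a) '' (f.ker : Set A) := by
    ext x
    simp only [Set.mem_preimage, Set.mem_singleton_iff, Set.mem_image, SetLike.mem_coe,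
      AddMonoidHom.mem_ker]
    constructor
    · intro h
      exact ⟨x - a, by rw [map_sub, h, sub_self], sub_add_cancel x a⟩
    · rintro ⟨y, hy, rfl⟩
      rw [map_add, hy, zero_add]
  rw [h1, Set.ncard_image_of_injective _ (add_left_injective a),
    AddSubgroup.card_eq_card_quotient_mul_card_addSubgroup f.ker, mul_comm,
    Nat.card_congr (QuotientAddGroup.quotientKerEquivOfSurjective f hf).toEquiv]
  rfl

section Model

variable {K T : Type*} [Field K] [Algebra (ZMod 2) K] [AddCommGroup T] [Module (ZMod 2) T]
variable {π : K →ₗ[ZMod 2] T}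

/-- Turns both kinds of intersection number into a count of `w ∈ K²`; `P` stands for the outward or
the inward condition. -/
theorem ncard_adj_and_dist (hπ : Function.Surjective π) (p q : ZMod 2 × (K × K) × T)
    (P : ℕ → Prop) :
    {r | (paraGraph π).Adj q r ∧ P ((paraGraph π).dist p r)}.ncard =
      {w | P (paraDist π (p + q + paraPoint π w))}.ncard := by
  rw [← Set.ncard_image_of_injective _ ((add_right_injective q).comp (paraPoint_injective π))]
  congr 1
  ext r
  simp only [Set.mem_ofPred_eq, Set.mem_image, dist_paraGraph hπ, Function.comp]
  constructor
  · rintro ⟨⟨w, rfl⟩, h⟩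
    exact ⟨w, by rwa [add_assoc], rfl⟩
  · rintro ⟨w, h, rfl⟩
    exact ⟨⟨w, rfl⟩, by rwa [← add_assoc]⟩

/-- The map `w ↦ π (B (z, w))`, where `B` is the polar form of `(x, y) ↦ x y`. -/
def polarHom (π : K →ₗ[ZMod 2] T) (z : K × K) : K × K →+ T :=
  AddMonoidHom.mk' (fun w => π (z.1 * w.2 + w.1 * z.2)) fun w w' => by
    rw [← map_add]
    congr 1
    simp only [Prod.fst_add, Prod.snd_add]
    ring

/-- Radii 3 and 4 require two distinct elements of `T`. -/
theorem paraDist_le_two [Subsingleton T] (p : ZMod 2 × (K × K) × T) : paraDist π p ≤ 2 := by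
  unfold paraDist
  split_ifs with h1 h2 h3 h4
  · omega
  · exact absurd (Subsingleton.elim _ _) h3
  · omega
  · omega
  · exact absurd (Subsingleton.elim _ _) h4

theorem ncard_neighborSet (π : K →ₗ[ZMod 2] T) (p : ZMod 2 × (K × K) × T) :
    ((paraGraph π).neighborSet p).ncard = Nat.card (K × K) := by
  have h : (paraGraph π).neighborSet p = Set.range fun w => p + paraPoint π w := by
    ext r
    exact ⟨fun ⟨w, hw⟩ => ⟨w, hw.symm⟩, fun ⟨w, hw⟩ => ⟨w, hw.symm⟩⟩
  rw [h, ← Set.image_univ, Set.ncard_image_of_injective Set.univ (f := fun w => p + paraPoint π w)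
    ((add_right_injective p).comp (paraPoint_injective π)), Set.ncard_univ]

/-- Identifies the antipodal classes as the cosets of `0 × 0 × T`. -/
theorem paraDist_eq_four_iff (π : K →ₗ[ZMod 2] T) (p : ZMod 2 × (K × K) × T) :
    paraDist π p = 4 ↔ p ≠ 0 ∧ p.1 = 0 ∧ p.2.1 = 0 := by
  rcases paraDist_cases π p with rfl | ⟨z, rfl⟩ | ⟨z, t, hz, rfl⟩ | ⟨z, t, hz, rfl⟩ | ⟨t, ht, rfl⟩
  · simp [paraDist_zero]
  · rw [paraDist_paraPoint]
    simp [paraPoint]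
  · simp [paraDist_even π hz, hz]
  · simp [paraDist_odd π hz]
  · simp [paraDist_top π ht, ht]

theorem dist_paraGraph_eq_four_iff (hπ : Function.Surjective π) (p q : ZMod 2 × (K × K) × T) :
    (paraGraph π).dist p q = 4 ↔ p ≠ q ∧ p.1 = q.1 ∧ p.2.1 = q.2.1 := by
  rw [dist_paraGraph hπ, paraDist_eq_four_iff]
  simp only [Ne, Prod.fst_add, Prod.snd_add, add_eq_zero_iff_eq_of_zmod]

variable [Finite K]

/-- By `eq_add_apply_mul_iff` the set is a fibre of the surjective homomorphism `w ↦ π (B (z, w))`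
from `K²` to `T`. -/
theorem ncard_near (hπ : Function.Surjective π) {c : ℕ} (hc : c * Nat.card T = Nat.card (K × K))
    {z : K × K} (hz : z ≠ 0) (t : T) :
    {w : K × K | t + π (w.1 * w.2) = π ((z + w).1 * (z + w).2)}.ncard = c := by
  have : Finite T := Finite.of_surjective _ hπ
  have hsurj : Function.Surjective (polarHom π z) := by
    intro s
    obtain ⟨k, rfl⟩ := hπ s
    obtain ⟨w, rfl⟩ := mul_swap_surjective hz k
    exact ⟨w, rfl⟩
  have h := ncard_preimage_singleton_mul_card _ hsurj (t + π (z.1 * z.2))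
  rw [← hc] at h
  rw [← Nat.eq_of_mul_eq_mul_right Nat.card_pos h]
  congr 1
  ext w
  exact eq_add_apply_mul_iff π z w t

/-- Each step flips the `𝔽₂`-coordinate. So from radius 2 the neighbours not counted by `ncard_near`
lie at radius 3, and from radius 3 only `w = z` makes the `K²`-coordinate vanish, reaching radius 4.
-/
theorem ncard_outward (hπ : Function.Surjective π) {c : ℕ}
    (hc : c * Nat.card T = Nat.card (K × K)) (p : ZMod 2 × (K × K) × T) :
    {w | paraDist π (p + paraPoint π w) = paraDist π p + 1}.ncard =
      [Nat.card (K × K), Nat.card (K × K) - 1, Nat.card (K × K) - c, 1].getD (paraDist π p) 0 := by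
  classical
  rcases paraDist_cases π p with rfl | ⟨z, rfl⟩ | ⟨z, t, hz, rfl⟩ | ⟨z, t, hz, rfl⟩ | ⟨t, ht, rfl⟩
  · simp [paraDist_zero, paraDist_paraPoint, Set.ncard_univ]
  · have : {w | paraDist π (paraPoint π z + paraPoint π w) = paraDist π (paraPoint π z) + 1}
        = {z}ᶜ := by
      ext w
      rw [Set.mem_ofPred_eq, paraDist_paraPoint, Set.mem_compl_iff, Set.mem_singleton_iff]
      by_cases h : w = z
      · subst h
        simp [ZModModule.add_self, paraDist_zero]
      · simp only [h, not_false_iff, iff_true]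
        nth_rewrite 1 [paraPoint]
        rw [odd_add_paraPoint, paraDist_even]
        rw [Ne, add_eq_zero_iff_eq_of_zmod]
        exact Ne.symm h
    rw [this, paraDist_paraPoint, Set.ncard_compl, Set.ncard_singleton]
    rfl
  · have : {w | paraDist π (((0, z, t) : ZMod 2 × (K × K) × T) + paraPoint π w) =
          paraDist π (0, z, t) + 1} =
        {w : K × K | t + π (w.1 * w.2) = π ((z + w).1 * (z + w).2)}ᶜ := by
      ext w
      rw [Set.mem_ofPred_eq, even_add_paraPoint, paraDist_one, paraDist_even π hz,
        Set.mem_compl_iff, Set.mem_ofPred_eq]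
      split_ifs with h
      · simp [-Prod.fst_add, -Prod.snd_add, h]
      · simp [-Prod.fst_add, -Prod.snd_add, h]
    rw [this, Set.ncard_compl, ncard_near hπ hc hz t, paraDist_even π hz]
    rfl
  · have : {w | paraDist π (((1, z, t) : ZMod 2 × (K × K) × T) + paraPoint π w) =
          paraDist π (1, z, t) + 1} = {z} := by
      ext w
      rw [Set.mem_ofPred_eq, odd_add_paraPoint, paraDist_odd π hz, Set.mem_singleton_iff]
      by_cases h : w = z
      · subst h
        rw [ZModModule.add_self, paraDist_top]
        · simp
        · rwa [Ne, add_eq_zero_iff_eq_of_zmod]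
      · rw [paraDist_even]
        · simp [h]
        · rw [Ne, add_eq_zero_iff_eq_of_zmod]
          exact Ne.symm h
    rw [this, paraDist_odd π hz, Set.ncard_singleton]
    rfl
  · have : {w | paraDist π (((0, 0, t) : ZMod 2 × (K × K) × T) + paraPoint π w) =
          paraDist π (0, 0, t) + 1} = ∅ := by
      ext w
      have := paraDist_le_four π (((0, 0, t) : ZMod 2 × (K × K) × T) + paraPoint π w)
      rw [Set.mem_ofPred_eq, paraDist_top π ht]
      simp only [Set.mem_empty_iff_false, iff_false]
      omega
    rw [this, paraDist_top π ht, Set.ncard_empty]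
    rfl

theorem ncard_inward (hπ : Function.Surjective π) {c : ℕ}
    (hc : c * Nat.card T = Nat.card (K × K)) (p : ZMod 2 × (K × K) × T) :
    {w | paraDist π (p + paraPoint π w) + 1 = paraDist π p}.ncard =
      [0, 1, c, Nat.card (K × K) - 1, Nat.card (K × K)].getD (paraDist π p) 0 := by
  classical
  rcases paraDist_cases π p with rfl | ⟨z, rfl⟩ | ⟨z, t, hz, rfl⟩ | ⟨z, t, hz, rfl⟩ | ⟨t, ht, rfl⟩
  · simp [paraDist_zero]
  · have : {w | paraDist π (paraPoint π z + paraPoint π w) + 1 = paraDist π (paraPoint π z)}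
        = {z} := by
      ext w
      rw [Set.mem_ofPred_eq, paraDist_paraPoint, Set.mem_singleton_iff]
      by_cases h : w = z
      · subst h
        simp [ZModModule.add_self, paraDist_zero]
      · simp only [h, iff_false]
        nth_rewrite 1 [paraPoint]
        rw [odd_add_paraPoint, paraDist_even]
        · omega
        · rw [Ne, add_eq_zero_iff_eq_of_zmod]
          exact Ne.symm h
    rw [this, paraDist_paraPoint, Set.ncard_singleton]
    rfl
  · have : {w | paraDist π (((0, z, t) : ZMod 2 × (K × K) × T) + paraPoint π w) + 1 =
          paraDist π (0, z, t)} =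
        {w : K × K | t + π (w.1 * w.2) = π ((z + w).1 * (z + w).2)} := by
      ext w
      rw [Set.mem_ofPred_eq, even_add_paraPoint, paraDist_one, paraDist_even π hz,
        Set.mem_ofPred_eq]
      split_ifs with h
      · simp [-Prod.fst_add, -Prod.snd_add, h]
      · simp [-Prod.fst_add, -Prod.snd_add, h]
    rw [this, ncard_near hπ hc hz t, paraDist_even π hz]
    rfl
  · have : {w | paraDist π (((1, z, t) : ZMod 2 × (K × K) × T) + paraPoint π w) + 1 =
          paraDist π (1, z, t)} = {z}ᶜ := by
      ext w
      rw [Set.mem_ofPred_eq, odd_add_paraPoint, paraDist_odd π hz, Set.mem_compl_iff,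
        Set.mem_singleton_iff]
      by_cases h : w = z
      · subst h
        rw [ZModModule.add_self, paraDist_top]
        · simp
        · rwa [Ne, add_eq_zero_iff_eq_of_zmod]
      · rw [paraDist_even]
        · simp [h]
        · rw [Ne, add_eq_zero_iff_eq_of_zmod]
          exact Ne.symm h
    rw [this, paraDist_odd π hz, Set.ncard_compl, Set.ncard_singleton]
    rfl
  · have : {w | paraDist π (((0, 0, t) : ZMod 2 × (K × K) × T) + paraPoint π w) + 1 =
          paraDist π (0, 0, t)} = Set.univ := by
      ext w
      rw [Set.mem_ofPred_eq, paraDist_top π ht, even_add_paraPoint, paraDist_odd]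
      · simp
      · simpa using ht
    rw [this, paraDist_top π ht, Set.ncard_univ]
    rfl

theorem diam_paraGraph (hπ : Function.Surjective π) [Nontrivial T] : (paraGraph π).diam = 4 := by
  have : Finite T := Finite.of_surjective _ hπ
  obtain ⟨t, ht⟩ := exists_ne (0 : T)
  refine diam_eq_of_dist _ (connected_paraGraph hπ) 4 (fun p q => ?_) ⟨0, (0, 0, t), ?_⟩
  · rw [dist_paraGraph hπ]
    exact paraDist_le_four π _
  · rw [dist_paraGraph hπ, zero_add, paraDist_top π ht]

theorem diam_paraGraph_of_subsingleton (hπ : Function.Surjective π) [Subsingleton T] :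
    (paraGraph π).diam = 2 := by
  have : Finite T := Finite.of_surjective _ hπ
  refine diam_eq_of_dist _ (connected_paraGraph hπ) 2 (fun p q => ?_) ⟨0, (0, (1, 0), 0), ?_⟩
  · rw [dist_paraGraph hπ]
    exact paraDist_le_two _
  · rw [dist_paraGraph hπ, zero_add, paraDist_even]
    exact fun h => one_ne_zero (congrArg Prod.fst h)

theorem isDistanceRegular_paraGraph (hπ : Function.Surjective π) [Nontrivial T] {c : ℕ}
    (hc : c * Nat.card T = Nat.card (K × K)) :
    IsDistanceRegular (paraGraph π)
      [Nat.card (K × K), Nat.card (K × K) - 1, Nat.card (K × K) - c, 1]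
      [1, c, Nat.card (K × K) - 1, Nat.card (K × K)] where
  connected := connected_paraGraph hπ
  diam_eq := diam_paraGraph hπ
  length_eq := rfl
  regular := ncard_neighborSet π
  outward p q := by
    rw [ncard_adj_and_dist hπ p q (fun k => k = (paraGraph π).dist p q + 1), dist_paraGraph hπ]
    exact ncard_outward hπ hc (p + q)
  inward p q := by
    rw [ncard_adj_and_dist hπ p q (fun k => k + 1 = (paraGraph π).dist p q), dist_paraGraph hπ]
    exact ncard_inward hπ hc (p + q)

theorem isDistanceRegular_paraGraph_of_subsingleton (hπ : Function.Surjective π)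
    [Subsingleton T] :
    IsDistanceRegular (paraGraph π) [Nat.card (K × K), Nat.card (K × K) - 1]
      [1, Nat.card (K × K)] where
  connected := connected_paraGraph hπ
  diam_eq := diam_paraGraph_of_subsingleton hπ
  length_eq := rfl
  regular := ncard_neighborSet π
  outward p q := by
    -- For trivial `T` the constant `c` is `|K²|`, so the third entry `|K²| - c` is 0, the default
    -- value of the shorter list; radii above 2 do not occur.
    have hc : Nat.card (K × K) * Nat.card T = Nat.card (K × K) := by simp
    rw [ncard_adj_and_dist hπ p q (fun k => k = (paraGraph π).dist p q + 1), dist_paraGraph hπ,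
      ncard_outward hπ hc (p + q)]
    have h := paraDist_le_two (π := π) (p + q)
    interval_cases paraDist π (p + q) <;> simp
  inward p q := by
    have hc : Nat.card (K × K) * Nat.card T = Nat.card (K × K) := by simp
    rw [ncard_adj_and_dist hπ p q (fun k => k + 1 = (paraGraph π).dist p q), dist_paraGraph hπ,
      ncard_inward hπ hc (p + q)]
    have h := paraDist_le_two (π := π) (p + q)
    interval_cases paraDist π (p + q) <;> simp

theorem isAntipodal_paraGraph (hπ : Function.Surjective π) [Nontrivial T] :
    IsAntipodal (paraGraph π) where
  connected := connected_paraGraph hπ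
  three_le_diam := by rw [diam_paraGraph hπ]; omega
  cliques := by
    rw [diam_paraGraph hπ]
    intro p q h hne
    refine ⟨hne, (dist_paraGraph_eq_four_iff hπ p q).mpr ⟨hne, ?_⟩⟩
    obtain ⟨w⟩ := h
    clear hne
    -- Steps of length 4 keep the first two coordinates, so the ends of the walk share them.
    induction w with
    | nil => exact ⟨rfl, rfl⟩
    | cons h _ ih =>
      have h' := ((dist_paraGraph_eq_four_iff hπ _ _).mp h.2).2
      exact ⟨h'.1.trans ih.1, h'.2.trans ih.2⟩

end Model

/-! ### Distance-transitivity of the model graph -/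

section Model

variable {K T : Type*} [Field K] [Algebra (ZMod 2) K] [AddCommGroup T] [Module (ZMod 2) T]

/-- Some automorphism of the model graph fixes the origin and maps `p` to `q`. -/
def Movable (π : K →ₗ[ZMod 2] T) (p q : ZMod 2 × (K × K) × T) : Prop :=
  ∃ φ : paraGraph π ≃g paraGraph π, φ 0 = 0 ∧ φ p = q

variable {π : K →ₗ[ZMod 2] T}

theorem Movable.symm {p q : ZMod 2 × (K × K) × T} (h : Movable π p q) : Movable π q p := by
  obtain ⟨φ, h0, rfl⟩ := h
  exact ⟨φ.symm, by rw [← h0, RelIso.symm_apply_apply, h0], RelIso.symm_apply_apply φ p⟩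

theorem Movable.trans {p q r : ZMod 2 × (K × K) × T} (h : Movable π p q) (h' : Movable π q r) :
    Movable π p r := by
  obtain ⟨φ, h0, rfl⟩ := h
  obtain ⟨φ', h0', rfl⟩ := h'
  exact ⟨φ.trans φ', by simp [h0, h0'], rfl⟩

/-- An additive bijection that permutes the paraboloid is an automorphism. -/
theorem movable_of_additive (f : ZMod 2 × (K × K) × T → ZMod 2 × (K × K) × T)
    (hf : Function.Bijective f) (hadd : ∀ p q, f (p + q) = f p + f q) (σ : K × K → K × K)
    (hσ : Function.Surjective σ) (h : ∀ z, f (paraPoint π z) = paraPoint π (σ z))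
    (p : ZMod 2 × (K × K) × T) : Movable π p (f p) := by
  refine ⟨⟨Equiv.ofBijective f hf, ?_⟩, (AddMonoidHom.mk' f hadd).map_zero, rfl⟩
  intro p q
  simp only [Equiv.ofBijective_apply, paraGraph]
  constructor
  · rintro ⟨w, hw⟩
    obtain ⟨z, rfl⟩ := hσ w
    exact ⟨z, hf.1 (by rw [hw, hadd, h])⟩
  · rintro ⟨z, rfl⟩
    exact ⟨σ z, by rw [hadd, h]⟩

/-- The translation `z ↦ z + c` of the paraboloid, extended additively: it moves `z` only on the
layer `a = 1`, while on `a = 0` it shears `t` by `π (B (z, c))`. It is an involution because `B (c,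
c) = 0`. -/
theorem movable_affine (c : K × K) (a : ZMod 2) (z : K × K) (t : T) :
    Movable π (a, z, t)
      (a, z + a • c, t + (a • π (c.1 * c.2) + π (z.1 * c.2 + c.1 * z.2))) := by
  have h2 : ∀ z : K × K, π (z.1 * c.2 + c.1 * z.2) = polarHom π c z := fun z => by
    rw [add_comm]
    simp only [polarHom, AddMonoidHom.mk'_apply, mul_comm z.1]
  let f : ZMod 2 × (K × K) × T → ZMod 2 × (K × K) × T := fun p =>
    (p.1, p.2.1 + p.1 • c,
      p.2.2 + (p.1 • π (c.1 * c.2) + π (p.2.1.1 * c.2 + c.1 * p.2.1.2)))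
  have hinv : Function.Involutive f := by
    rintro ⟨a, z, t⟩
    have hcc : polarHom π c c = 0 := by
      rw [← h2, ZModModule.add_self, map_zero]
    rcases zmod_two_cases a with rfl | rfl
    · simp only [f, zero_smul, add_zero, zero_add, add_add_self]
    · simp only [f, one_smul, add_add_self, h2, map_add, hcc, add_zero]
  refine movable_of_additive f hinv.bijective ?_ (fun z => z + c) (add_right_surjective c) ?_
    (a, z, t)
  · rintro ⟨a, z, t⟩ ⟨b, z', t'⟩
    simp only [f, Prod.mk_add_mk, add_smul, h2, map_add, Prod.mk.injEq, true_and]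
    constructor <;> abel
  · intro z
    simp only [f, paraPoint, one_smul, Prod.mk.injEq, true_and, Prod.fst_add, Prod.snd_add,
      ← map_add]
    congr 1
    ring

theorem movable_swap (a : ZMod 2) (z : K × K) (t : T) : Movable π (a, z, t) (a, z.swap, t) := by
  let f : ZMod 2 × (K × K) × T → ZMod 2 × (K × K) × T := fun p => (p.1, p.2.1.swap, p.2.2)
  have hinv : Function.Involutive f := fun _ => rfl
  refine movable_of_additive f hinv.bijective (fun _ _ => rfl) Prod.swap Prod.swap_surjective ?_
    (a, z, t)
  intro z
  simp [f, paraPoint, mul_comm]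

/-- The map `y ↦ y + l x` changes `x y` by `l x²`, which is additive in characteristic 2 and so can
be absorbed into the `T`-coordinate. -/
theorem movable_shear (l : K) (a : ZMod 2) (z : K × K) (t : T) :
    Movable π (a, z, t) (a, (z.1, z.2 + l * z.1), t + π (l * z.1 ^ 2)) := by
  have : CharP K 2 := charP_of_injective_algebraMap (algebraMap (ZMod 2) K).injective 2
  let f : ZMod 2 × (K × K) × T → ZMod 2 × (K × K) × T := fun p =>
    (p.1, (p.2.1.1, p.2.1.2 + l * p.2.1.1), p.2.2 + π (l * p.2.1.1 ^ 2))
  have hinv : Function.Involutive f := by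
    rintro ⟨a, z, t⟩
    simp only [f, add_add_self]
  have hinv' : Function.Involutive fun z : K × K => (z.1, z.2 + l * z.1) := by
    rintro z
    simp only [add_add_self]
  refine movable_of_additive f hinv.bijective ?_ _ hinv'.surjective ?_ (a, z, t)
  · intro p q
    simp only [f, Prod.fst_add, Prod.snd_add, CharTwo.add_sq, mul_add, map_add,
      Prod.mk_add_mk, Prod.mk.injEq, true_and]
    constructor <;> abel
  · intro z
    simp only [f, paraPoint, Prod.mk.injEq, true_and, ← map_add]
    congr 1
    ring

theorem movable_even (hπ : Function.Surjective π) {z : K × K} (hz : z ≠ 0) (t : T) :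
    Movable π (0, z, t) (0, (1, 0), 0) := by
  have h1 : ∀ (x : K) (t : T), ∃ t', Movable π (0, (x, 1), t) (0, (1, 0), t') := by
    intro x t
    have h := (movable_swap (π := π) 0 (x, 1) t).trans (movable_shear x 0 (1, x) t)
    simp only [mul_one, ZModModule.add_self] at h
    exact ⟨_, h⟩
  have h2 : ∃ t', Movable π (0, z, t) (0, (1, 0), t') := by
    by_cases hx : z.1 = 0
    · have hy : z.2 ≠ 0 := fun hy => hz (Prod.ext hx hy)
      -- The swap gives `(z.2, 0)`, and this factor shears it to `(z.2, 1)`.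
      have hm := (movable_swap (π := π) 0 z t).trans (movable_shear (1 / z.2) 0 _ t)
      rw [Prod.fst_swap, Prod.snd_swap, hx, zero_add, one_div_mul_cancel hy] at hm
      obtain ⟨t', ht'⟩ := h1 z.2 (t + π (1 / z.2 * z.2 ^ 2))
      exact ⟨t', hm.trans ht'⟩
    -- The factor is chosen so that the second coordinate becomes `z.2 + (1 + z.2) = 1`.
    · have hm := movable_shear (π := π) ((1 + z.2) / z.1) 0 z t
      rw [div_mul_cancel₀ _ hx, add_left_comm, ZModModule.add_self, add_zero] at hm
      obtain ⟨t', ht'⟩ := h1 z.1 (t + π ((1 + z.2) / z.1 * z.1 ^ 2))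
      exact ⟨t', hm.trans ht'⟩
  obtain ⟨t', ht'⟩ := h2
  obtain ⟨k, rfl⟩ := hπ t'
  refine ht'.trans ?_
  -- With `c = (0, k)` the polar form at `(1, 0)` is `k`, which cancels `t' = π k`.
  have h := movable_affine (π := π) (0, k) 0 (1, 0) (π k)
  simpa [ZModModule.add_self] using h

/-- Translating by `c = z` clears the `K²`-coordinate; what remains in `T` measures the deviation
from the paraboloid, zero exactly at distance 1. -/
theorem movable_odd (z : K × K) (t : T) :
    Movable π (1, z, t) (1, 0, t + π (z.1 * z.2)) := by
  have h := movable_affine (π := π) z 1 z t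
  simpa only [one_smul, ZModModule.add_self, map_zero, add_zero] using h

/-- Additive bijections of the two coordinates of `K²` that induce an additive bijection of `T`
carrying `t` to `t'`. -/
def Twistable (π : K →ₗ[ZMod 2] T) (t t' : T) : Prop :=
  ∃ (ψ₁ ψ₂ : K ≃+ K) (τ : T ≃+ T), (∀ x y, π (ψ₁ x * ψ₂ y) = τ (π (x * y))) ∧ τ t = t'

theorem Twistable.refl (π : K →ₗ[ZMod 2] T) (t : T) : Twistable π t t :=
  ⟨AddEquiv.refl K, AddEquiv.refl K, AddEquiv.refl T, fun _ _ => rfl, rfl⟩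

theorem Twistable.trans {t t' t'' : T} (h : Twistable π t t') (h' : Twistable π t' t'') :
    Twistable π t t'' := by
  obtain ⟨ψ₁, ψ₂, τ, h, rfl⟩ := h
  obtain ⟨ψ₁', ψ₂', τ', h', rfl⟩ := h'
  exact ⟨ψ₁.trans ψ₁', ψ₂.trans ψ₂', τ.trans τ', fun x y => by simp [h, h'], rfl⟩

theorem Twistable.movable {t t' : T} (h : Twistable π t t') (a : ZMod 2) :
    Movable π (a, 0, t) (a, 0, t') := by
  obtain ⟨ψ₁, ψ₂, τ, h, rfl⟩ := h
  let f : ZMod 2 × (K × K) × T ≃+ ZMod 2 × (K × K) × T :=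
    (AddEquiv.refl (ZMod 2)).prodCongr ((ψ₁.prodCongr ψ₂).prodCongr τ)
  have hf : ∀ a z t, f (a, z, t) = (a, (ψ₁ z.1, ψ₂ z.2), τ t) := fun _ _ _ => rfl
  have hm := movable_of_additive (π := π) f f.bijective (map_add f) (ψ₁.prodCongr ψ₂)
    (AddEquiv.surjective _) (fun z => ?_) (a, 0, t)
  · rw [hf] at hm
    simpa [← Prod.zero_eq_mk] using hm
  · rw [paraPoint, hf, ← h]
    rfl

/-- The spheres about the origin are orbits of its stabiliser; `H` is needed only for radii 3 and 4.
-/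
theorem movable_of_paraDist_eq (hπ : Function.Surjective π)
    (H : ∀ t t' : T, t ≠ 0 → t' ≠ 0 → Twistable π t t') (p q : ZMod 2 × (K × K) × T)
    (h : paraDist π p = paraDist π q) : Movable π p q := by
  rcases paraDist_cases π p with rfl | ⟨z, rfl⟩ | ⟨z, t, hz, rfl⟩ | ⟨z, t, hz, rfl⟩ | ⟨t, ht, rfl⟩
    <;> rcases paraDist_cases π q with
      rfl | ⟨z', rfl⟩ | ⟨z', t', hz', rfl⟩ | ⟨z', t', hz', rfl⟩ | ⟨t', ht', rfl⟩
    -- Unequal radii contradict `h`, leaving the five diagonal pairs.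
    <;> simp only [paraDist_zero, paraDist_paraPoint, paraDist_even, paraDist_odd, paraDist_top,
      *, Nat.reduceEqDiff, OfNat.zero_ne_ofNat, zero_ne_one, one_ne_zero,
      OfNat.ofNat_ne_zero, OfNat.ofNat_ne_one, OfNat.one_ne_ofNat, ne_eq, not_false_eq_true] at h
  · exact ⟨RelIso.refl _, rfl, rfl⟩
  · have h1 : ∀ z, Movable π (paraPoint π z) (1, 0, 0) := fun z => by
      have := movable_odd (π := π) z (π (z.1 * z.2))
      rwa [ZModModule.add_self] at this
    exact (h1 z).trans (h1 z').symm
  · exact (movable_even hπ hz t).trans (movable_even hπ hz' t').symm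
  · refine ((movable_odd z t).trans ((H _ _ ?_ ?_).movable 1)).trans (movable_odd z' t').symm
    · rwa [Ne, add_eq_zero_iff_eq_of_zmod]
    · rwa [Ne, add_eq_zero_iff_eq_of_zmod]
  · exact (H t t' ht ht').movable 0

theorem isDistanceTransitive_paraGraph (hπ : Function.Surjective π)
    (H : ∀ t t' : T, t ≠ 0 → t' ≠ 0 → Twistable π t t') :
    IsDistanceTransitive (paraGraph π) where
  connected := connected_paraGraph hπ
  transitive p q p' q' h := by
    rw [dist_paraGraph hπ, dist_paraGraph hπ] at h
    obtain ⟨φ, h0, h1⟩ := movable_of_paraDist_eq hπ H _ _ h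
    refine ⟨((paraGraphTranslation π p).trans φ).trans (paraGraphTranslation π p'), ?_, ?_⟩
    · change φ (p + p) + p' = p'
      rw [ZModModule.add_self, h0, zero_add]
    · change φ (q + p) + p' = q'
      rw [add_comm q, h1, add_comm p', add_add_self]

/-! ### The three situations in which the automorphisms act transitively on `T \ {0}` -/

/-- Here `T` is a copy of `K`; multiplying one coordinate by `k' / k` multiplies every product by
it. -/
theorem twistable_of_injective (hπ : Function.Bijective π) {t t' : T} (ht : t ≠ 0)
    (ht' : t' ≠ 0) : Twistable π t t' := by
  let e : K ≃+ T := AddEquiv.ofBijective π hπ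
  obtain ⟨k, rfl⟩ := e.surjective t
  obtain ⟨k', rfl⟩ := e.surjective t'
  have hk : k ≠ 0 := fun h => ht (by rw [h, map_zero])
  have hk' : k' ≠ 0 := fun h => ht' (by rw [h, map_zero])
  let ψ : K ≃+ K := AddAut.mulLeft (Units.mk0 (k' / k) (div_ne_zero hk' hk))
  refine ⟨ψ, AddEquiv.refl K, (e.symm.trans ψ).trans e, fun x y => ?_, ?_⟩
  · change e (k' / k * x * y) = e (k' / k * e.symm (e (x * y)))
    rw [e.symm_apply_apply, mul_assoc]
  · change e (k' / k * e.symm (e k)) = _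
    rw [e.symm_apply_apply, div_mul_cancel₀ _ hk]

theorem twistable_of_card_two (π : K →ₗ[ZMod 2] T) (hT : Nat.card T = 2) {t t' : T} (ht : t ≠ 0)
    (ht' : t' ≠ 0) : Twistable π t t' := by
  obtain ⟨s, -, hs⟩ := (Nat.card_eq_two_iff' (0 : T)).mp hT
  rw [hs t ht, hs t' ht']
  exact Twistable.refl π s

/-- Squaring, rescaled so as to fix `w`, permutes the nonzero cosets of `{0, w}` in the field with
eight elements without fixed points. -/
theorem twistable_of_card_eight (hπ : Function.Surjective π) (hK : Nat.card K = 8)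
    (hT : Nat.card T = 4) {t t' : T} (ht : t ≠ 0) (ht' : t' ≠ 0) : Twistable π t t' := by
  have : CharP K 2 := charP_of_injective_algebraMap (algebraMap (ZMod 2) K).injective 2
  have hfin : Finite K := Nat.finite_of_card_ne_zero (by rw [hK]; norm_num)
  have hfinT : Finite T := Finite.of_surjective _ hπ
  have hker : (π ⁻¹' {0}).ncard = 2 := by
    have := ncard_preimage_singleton_mul_card π.toAddMonoidHom hπ 0
    rw [hT, hK] at this
    have h : (π ⁻¹' {0}).ncard * 4 = 8 := this
    omega
  obtain ⟨w, hw0, hw⟩ : ∃ w : K, w ≠ 0 ∧ ∀ k, π k = 0 ↔ k = 0 ∨ k = w := by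
    obtain ⟨x, y, hxy, hS⟩ := Set.ncard_eq_two.mp hker
    have hmem : ∀ k, π k = 0 ↔ k = x ∨ k = y := fun k => by
      have : k ∈ π ⁻¹' {0} ↔ k ∈ ({x, y} : Set K) := by rw [hS]
      simpa using this
    rcases (hmem 0).mp (map_zero π) with rfl | rfl
    · exact ⟨y, hxy.symm, hmem⟩
    · exact ⟨x, hxy, fun k => (hmem k).trans or_comm⟩
  let ψ₂ : K ≃+ K := AddEquiv.ofBijective (frobenius K 2).toAddMonoidHom
    (Finite.injective_iff_bijective.mp (frobenius_inj K 2))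
  -- The factor `w⁻¹` makes `ψ₁ w = w`, so `ψ₁` preserves the kernel `{0, w}` of `π` and descends to
  -- `T`.
  let ψ₁ : K ≃+ K := ψ₂.trans (AddAut.mulLeft (Units.mk0 w⁻¹ (inv_ne_zero hw0)))
  have hψ₁ : ∀ x, ψ₁ x = w⁻¹ * x ^ 2 := fun _ => rfl
  have hψ₂ : ∀ x, ψ₂ x = x ^ 2 := fun _ => rfl
  have hkerψ : ∀ k, π (ψ₁ k) = 0 ↔ π k = 0 := by
    intro k
    rw [hw, hw, hψ₁]
    constructor
    · rintro (h | h)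
      · exact Or.inl (by simpa [hw0] using h)
      · right
        rw [inv_mul_eq_iff_eq_mul₀ hw0, ← sq] at h
        exact frobenius_inj K 2 h
    · rintro (rfl | rfl)
      · left; simp
      · right; field_simp
  obtain ⟨g, hg⟩ := hπ.hasRightInverse
  have hcongr : ∀ k k', π k = π k' → π (ψ₁ k) = π (ψ₁ k') := fun k k' h => by
    rw [← sub_eq_zero, ← map_sub, ← map_sub, hkerψ, map_sub, h, sub_self]
  have hτ : ∀ k, π (ψ₁ (g (π k))) = π (ψ₁ k) := fun k => hcongr _ _ (hg (π k))
  let τ₀ : T →+ T := AddMonoidHom.mk' (fun t => π (ψ₁ (g t))) fun a b => by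
    rw [← map_add, ← map_add]
    refine hcongr _ _ ?_
    rw [map_add, hg, hg, hg]
  have hτ₀ : ∀ k, τ₀ (π k) = π (ψ₁ k) := hτ
  have hinj : Function.Injective τ₀ := by
    refine (injective_iff_map_eq_zero τ₀).mpr fun s hs => ?_
    obtain ⟨k, rfl⟩ := hπ s
    rwa [hτ₀, hkerψ] at hs
  have hne : ∀ s, s ≠ 0 → τ₀ s ≠ s := by
    intro s hs h
    obtain ⟨k, rfl⟩ := hπ s
    rw [hτ₀, ← sub_eq_zero, ← map_sub, hw, hψ₁, sub_eq_zero, sub_eq_iff_eq_add] at h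
    rw [Ne, hw, not_or] at hs
    have h8 : ∀ k : K, k ^ 8 = k := fun k => by
      have : Fintype K := Fintype.ofFinite K
      rw [← hK, Nat.card_eq_fintype_card, FiniteField.pow_card]
    have h2 : (2 : K) = 0 := CharTwo.two_eq_zero
    rcases h with h | h
    · rw [inv_mul_eq_iff_eq_mul₀ hw0, sq] at h
      exact hs.2 (mul_right_cancel₀ hs.1 h)
    · rw [inv_mul_eq_iff_eq_mul₀ hw0] at h
      -- Here `h` says `k² + w k + w² = 0`, a factor of `k³ - w³`. Cubing is injective on the field
      -- of order 8, since `(x³)³ = x · x⁸ = x²`.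
      have h3 : k ^ 3 = w ^ 3 := by linear_combination (k + w) * h + w ^ 2 * k * h2
      refine hs.2 (frobenius_inj K 2 ?_)
      change k ^ 2 = w ^ 2
      calc k ^ 2 = k * k ^ 8 := by rw [h8 k, sq]
        _ = (k ^ 3) ^ 3 := by ring
        _ = w * w ^ 8 := by rw [h3]; ring
        _ = w ^ 2 := by rw [h8 w, sq]
  let τ : T ≃+ T := AddEquiv.ofBijective τ₀ (Finite.injective_iff_bijective.mp hinj)
  -- The twisting identity is `(w⁻¹ x²) y² = w⁻¹ (x y)²`.
  have step : ∀ s, Twistable π s (τ₀ s) := fun s =>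
    ⟨ψ₁, ψ₂, τ, fun x y => by
      change _ = τ₀ (π (x * y))
      rw [hτ₀, hψ₁, hψ₁, hψ₂, mul_pow, mul_assoc], rfl⟩
  -- Without a nonzero fixed point of `τ₀` the four listed elements are distinct, and `T` has only
  -- four.
  have hex : ∀ s, s = 0 ∨ s = t ∨ s = τ₀ t ∨ s = t + τ₀ t := by
    intro s
    by_contra hcon
    simp only [not_or] at hcon
    have h0 : τ₀ t ≠ 0 := fun h => ht (hinj (by rw [h, map_zero]))
    have hcard : ({s, 0, t, τ₀ t, t + τ₀ t} : Set T).ncard = 5 := by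
      have e1 : t + τ₀ t ≠ 0 := by
        rw [Ne, add_eq_zero_iff_eq_of_zmod]
        exact (hne t ht).symm
      rw [Set.ncard_insert_of_notMem, Set.ncard_insert_of_notMem, Set.ncard_insert_of_notMem,
        Set.ncard_pair]
      · simpa using ht
      · simp [(hne t ht).symm, h0]
      · simp [ht.symm, h0.symm, e1.symm]
      · simp [hcon]
    have := Set.ncard_le_card ({s, 0, t, τ₀ t, t + τ₀ t} : Set T)
    omega
  rcases hex t' with h | rfl | rfl | rfl
  · exact absurd h ht'
  · exact Twistable.refl π _
  · exact step t
  -- Otherwise `τ₀` would swap `t` with `τ₀ t` and fix their nonzero sum, or fix `τ₀ t`; so it is a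
  -- 3-cycle on the nonzero elements.
  · have h1 : τ₀ (τ₀ t) = t + τ₀ t := by
      have h0 : τ₀ t ≠ 0 := fun h => ht (hinj (by rw [h, map_zero]))
      rcases hex (τ₀ (τ₀ t)) with h | h | h | h
      · exact absurd (hinj (h.trans (map_zero τ₀).symm)) h0
      · exfalso
        refine hne (t + τ₀ t) ht' ?_
        rw [map_add, h, add_comm]
      · exact absurd h (hne _ h0)
      · exact h
    have := (step t).trans (step (τ₀ t))
    rwa [h1] at this

end Model

/-! ### Transport of the graph properties -/

section Transport

variable {V W : Type*} {G : SimpleGraph V} {H : SimpleGraph W}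

theorem diam_eq_of_iso (φ : G ≃g H) : G.diam = H.diam := by
  rw [SimpleGraph.diam_def, SimpleGraph.diam_def]
  congr 1
  exact (Equiv.prodCongr φ.toEquiv φ.toEquiv).iSup_congr fun p => edist_iso_apply φ p.1 p.2

theorem ncard_setOf_iso (φ : G ≃g H) (P : W → Prop) : {z | P (φ z)}.ncard = {w | P w}.ncard :=
  Set.ncard_congr' (φ.toEquiv.subtypeEquiv fun _ => Iff.rfl)

theorem IsDistanceRegular.of_iso (φ : G ≃g H) {b c : List ℕ} (h : IsDistanceRegular H b c) :
    IsDistanceRegular G b c where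
  connected := φ.connected_iff.mpr h.connected
  diam_eq := (diam_eq_of_iso φ).trans h.diam_eq
  length_eq := h.length_eq
  regular x := by
    rw [← h.regular (φ x), SimpleGraph.neighborSet, SimpleGraph.neighborSet,
      ← ncard_setOf_iso φ]
    simp only [φ.map_adj_iff]
  outward x y := by
    rw [← dist_iso_apply φ x y, ← h.outward (φ x) (φ y), ← ncard_setOf_iso φ]
    simp only [φ.map_adj_iff, dist_iso_apply φ]
  inward x y := by
    rw [← dist_iso_apply φ x y, ← h.inward (φ x) (φ y), ← ncard_setOf_iso φ]
    simp only [φ.map_adj_iff, dist_iso_apply φ]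

theorem IsAntipodal.of_iso (φ : G ≃g H) (h : IsAntipodal H) : IsAntipodal G where
  connected := φ.connected_iff.mpr h.connected
  three_le_diam := (diam_eq_of_iso φ).symm ▸ h.three_le_diam
  cliques x y hr hne := by
    have hadj : ∀ a b, (distanceGraph H H.diam).Adj (φ a) (φ b) ↔
        (distanceGraph G G.diam).Adj a b := fun a b => by
      simp only [distanceGraph, dist_iso_apply φ, diam_eq_of_iso φ, Ne, φ.injective.eq_iff]
    let f : distanceGraph G G.diam →g distanceGraph H H.diam := ⟨φ, fun h => (hadj _ _).mpr h⟩
    exact (hadj x y).mp (h.cliques _ _ (hr.map f) (φ.injective.ne hne))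

theorem IsDistanceTransitive.of_iso (φ : G ≃g H) (h : IsDistanceTransitive H) :
    IsDistanceTransitive G where
  connected := φ.connected_iff.mpr h.connected
  transitive x y x' y' hd := by
    rw [← dist_iso_apply φ, ← dist_iso_apply φ] at hd
    obtain ⟨ψ, hx, hy⟩ := h.transitive _ _ _ _ hd
    exact ⟨(φ.trans ψ).trans φ.symm, φ.symm_apply_eq.mpr hx, φ.symm_apply_eq.mpr hy⟩

end Transport

section Model

variable {K T : Type*} [Field K] [Algebra (ZMod 2) K] [AddCommGroup T] [Module (ZMod 2) T]

/-! ### The degenerate model graph and the coverings -/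

/-- For trivial `T` the paraboloid is the whole layer `a = 1`, so adjacency means different
`𝔽₂`-coordinates. -/
theorem nonempty_iso_completeBipartiteGraph (π : K →ₗ[ZMod 2] T) [Subsingleton T] [Finite K]
    {M : ℕ} (hM : Nat.card (K × K) = M) :
    Nonempty (paraGraph π ≃g completeBipartiteGraph (Fin M) (Fin M)) := by
  have e : (K × K) × T ≃ Fin M := by
    refine Nat.equivFinOfCardPos ?_ |>.trans (finCongr ?_)
    · exact (Nat.card_pos (α := (K × K) × T)).ne'
    · rw [Nat.card_prod, hM]
      simp
  have f : ZMod 2 ≃ Bool := finTwoEquiv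
  refine ⟨⟨(f.prodCongr e).trans (Equiv.boolProdEquivSum _), ?_⟩⟩
  have hadj : ∀ p q, (paraGraph π).Adj p q ↔ p.1 ≠ q.1 := by
    rintro ⟨a, z, t⟩ ⟨b, z', t'⟩
    have hab : a ≠ b ↔ b = a + 1 := by revert a b; decide
    rw [hab]
    constructor
    · rintro ⟨w, hw⟩
      exact congrArg Prod.fst hw
    · rintro rfl
      refine ⟨z + z', Prod.ext rfl (Prod.ext ?_ (Subsingleton.elim _ _))⟩
      exact (self_add_add z z').symm
  rintro ⟨a, x⟩ ⟨b, y⟩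
  rw [hadj]
  rw [← f.injective.ne_iff]
  simp only [Equiv.trans_apply, Equiv.prodCongr_apply, Prod.map_apply]
  generalize f a = a'
  generalize f b = b'
  cases a' <;> cases b' <;> simp [Equiv.boolProdEquivSum]

/-- The map is additive and sends each `paraPoint π w` to the point with the same `w`; both
neighbourhoods are indexed by `K²`. -/
theorem bijOn_neighborSet_paraGraph {T' : Type*} [AddCommGroup T'] [Module (ZMod 2) T']
    (π : K →ₗ[ZMod 2] T) (ρ : T →ₗ[ZMod 2] T') (p : ZMod 2 × (K × K) × T) :
    Set.BijOn (fun p : ZMod 2 × (K × K) × T => (p.1, p.2.1, ρ p.2.2))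
      ((paraGraph π).neighborSet p) ((paraGraph (ρ ∘ₗ π)).neighborSet (p.1, p.2.1, ρ p.2.2)) := by
  have h : ∀ w, (fun p : ZMod 2 × (K × K) × T => (p.1, p.2.1, ρ p.2.2)) (p + paraPoint π w) =
      (p.1, p.2.1, ρ p.2.2) + paraPoint (ρ ∘ₗ π) w := fun w => by
    simp [paraPoint]
  refine ⟨?_, ?_, ?_⟩
  · rintro _ ⟨w, rfl⟩
    exact ⟨w, h w⟩
  · rintro _ ⟨w, rfl⟩ _ ⟨w', rfl⟩ hw
    rw [h, h, add_right_inj] at hw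
    rw [paraPoint_injective _ hw]
  · rintro _ ⟨w, rfl⟩
    exact ⟨_, ⟨w, rfl⟩, h w⟩

/-! ### The coset graph of a code with parity check columns on the paraboloid -/

/-- This makes the syndrome map onto. The `T`-direction comes from the non-additivity of `x y`: the
points over `(k, 0)`, `(0, 1)` and `(k, 1)`, shifted to `a = 0`, sum to `(0, 0, π k)`. -/
theorem span_range_paraPoint {π : K →ₗ[ZMod 2] T} (hπ : Function.Surjective π) :
    Submodule.span (ZMod 2) (Set.range (paraPoint π)) = ⊤ := by
  set S := Submodule.span (ZMod 2) (Set.range (paraPoint π)) with hS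
  have hmem : ∀ z, paraPoint π z ∈ S := fun z => Submodule.subset_span ⟨z, rfl⟩
  have h0 := hmem 0
  have hz : ∀ z, (0, z, π (z.1 * z.2)) ∈ S := fun z => by
    have := S.add_mem h0 (hmem z)
    simpa [paraPoint, ZModModule.add_self] using this
  have hk : ∀ k, ((0, 0, π k) : ZMod 2 × (K × K) × T) ∈ S := fun k => by
    have := S.add_mem (S.add_mem (hz (k, 0)) (hz (0, 1))) (hz (k, 1))
    simpa [ZModModule.add_self, ← Prod.zero_eq_mk] using this
  rw [eq_top_iff]
  rintro ⟨a, z, t⟩ -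
  obtain ⟨k, rfl⟩ := hπ t
  have := S.add_mem (S.add_mem (S.smul_mem a h0) (hz z)) (S.add_mem (hk (z.1 * z.2)) (hk k))
  simpa [paraPoint, self_add_add] using this

/-- The syndrome map of the code whose parity check columns are the points `pt j` of the
paraboloid. -/
noncomputable def paraSyndrome {N : ℕ} (π : K →ₗ[ZMod 2] T) (pt : Fin N ≃ K × K) :
    (Fin N → ZMod 2) →ₗ[ZMod 2] ZMod 2 × (K × K) × T :=
  Fintype.linearCombination (ZMod 2) (fun j => paraPoint π (pt j))

theorem paraSyndrome_surjective {N : ℕ} {π : K →ₗ[ZMod 2] T} (hπ : Function.Surjective π)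
    (pt : Fin N ≃ K × K) : Function.Surjective (paraSyndrome π pt) := by
  rw [← LinearMap.range_eq_top, paraSyndrome, Fintype.range_linearCombination,
    ← span_range_paraPoint hπ]
  congr 1
  exact pt.surjective.range_comp (paraPoint π)

theorem paraSyndrome_single {N : ℕ} (π : K →ₗ[ZMod 2] T) (pt : Fin N ≃ K × K) (j : Fin N) :
    paraSyndrome π pt (Pi.single j 1) = paraPoint π (pt j) := by
  simp [paraSyndrome]

theorem exists_eq_add_single {N : ℕ} {v w : Fin N → ZMod 2} (h : hammingDist v w = 1) :
    ∃ j, w = v + Pi.single j 1 := by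
  obtain ⟨j, hj⟩ := Finset.card_eq_one.mp h
  refine ⟨j, funext fun i => ?_⟩
  have hi : v i ≠ w i ↔ i = j := by
    rw [← Finset.mem_singleton, ← hj]
    simp
  by_cases hij : i = j
  · subst hij
    have := hi.mpr rfl
    rw [Pi.add_apply, Pi.single_eq_same]
    revert this
    generalize v i = a
    generalize w i = b
    revert a b
    decide
  · rw [Pi.add_apply, Pi.single_eq_of_ne hij, add_zero]
    by_contra hne
    exact hij (hi.mp fun h => hne h.symm)

theorem hammingDist_add_single {N : ℕ} (v : Fin N → ZMod 2) (j : Fin N) :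
    hammingDist v (v + Pi.single j 1) = 1 := by
  rw [hammingDist, Finset.card_eq_one]
  refine ⟨j, Finset.ext fun i => ?_⟩
  by_cases hij : i = j
  · subst hij; simp
  · simp [hij]

variable {N : ℕ} {π : K →ₗ[ZMod 2] T} {pt : Fin N ≃ K × K}
  {C : Submodule (ZMod 2) (Fin N → ZMod 2)}

/-- The cosets of a code correspond to its syndromes. -/
noncomputable def cosetEquiv (hπ : Function.Surjective π) (pt : Fin N ≃ K × K)
    (hC : C = LinearMap.ker (paraSyndrome π pt)) :
    ((Fin N → ZMod 2) ⧸ C) ≃ₗ[ZMod 2] ZMod 2 × (K × K) × T :=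
  (Submodule.quotEquivOfEq _ _ hC).trans
    (LinearMap.quotKerEquivOfSurjective _ (paraSyndrome_surjective hπ pt))

theorem cosetEquiv_mk (hπ : Function.Surjective π) (pt : Fin N ≃ K × K)
    (hC : C = LinearMap.ker (paraSyndrome π pt)) (v : Fin N → ZMod 2) :
    cosetEquiv hπ pt hC (Submodule.Quotient.mk v) = paraSyndrome π pt v := rfl

/-- The coset graph of a code with parity check columns on the paraboloid is the model graph. -/
noncomputable def cosetGraphIso (hπ : Function.Surjective π) (pt : Fin N ≃ K × K)
    (hC : C = LinearMap.ker (paraSyndrome π pt)) : cosetGraph C ≃g paraGraph π where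
  toEquiv := (cosetEquiv hπ pt hC).toEquiv
  map_rel_iff' := by
    intro B B'
    change (∃ z, cosetEquiv hπ pt hC B' = cosetEquiv hπ pt hC B + paraPoint π z) ↔ _
    constructor
    · rintro ⟨z, hz⟩
      obtain ⟨v, rfl⟩ := Submodule.Quotient.mk_surjective C B
      refine ⟨?_, v, v + Pi.single (pt.symm z) 1, rfl, ?_, hammingDist_add_single _ _⟩
      · rintro rfl
        exact one_ne_zero (congrArg Prod.fst (left_eq_add.mp hz))
      · apply (cosetEquiv hπ pt hC).injective
        rw [hz, cosetEquiv_mk, cosetEquiv_mk, map_add, paraSyndrome_single,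
          Equiv.apply_symm_apply]
    · rintro ⟨-, v, v', rfl, rfl, h⟩
      obtain ⟨j, rfl⟩ := exists_eq_add_single h
      exact ⟨pt j, by rw [cosetEquiv_mk, cosetEquiv_mk, map_add, paraSyndrome_single]⟩

theorem card_coset (hπ : Function.Surjective π) (pt : Fin N ≃ K × K)
    (hC : C = LinearMap.ker (paraSyndrome π pt)) :
    Nat.card ((Fin N → ZMod 2) ⧸ C) = 2 * N * Nat.card T := by
  rw [Nat.card_congr (cosetEquiv hπ pt hC).toEquiv, Nat.card_prod, Nat.card_prod,
    ← Nat.card_congr pt, Nat.card_fin, Nat.card_zmod, mul_assoc]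

/-! ### Coverings between coset graphs of nested codes -/

section Cover

variable {T' : Type*} [AddCommGroup T'] [Module (ZMod 2) T'] {ρ : T →ₗ[ZMod 2] T'}
  {C' : Submodule (ZMod 2) (Fin N → ZMod 2)}

theorem paraSyndrome_comp (π : K →ₗ[ZMod 2] T) (ρ : T →ₗ[ZMod 2] T') (pt : Fin N ≃ K × K)
    (v : Fin N → ZMod 2) : paraSyndrome (ρ ∘ₗ π) pt v =
      ((paraSyndrome π pt v).1, (paraSyndrome π pt v).2.1, ρ (paraSyndrome π pt v).2.2) := by
  simp only [paraSyndrome, Fintype.linearCombination_apply, paraPoint, Prod.fst_sum, Prod.snd_sum,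
    Prod.smul_mk, map_sum, map_smul, LinearMap.comp_apply]
  refine Prod.ext ?_ (Prod.ext ?_ ?_) <;> simp [Prod.fst_sum, Prod.snd_sum]

theorem cosetGraphIso_factor (hπ : Function.Surjective π) (hρπ : Function.Surjective (ρ ∘ₗ π))
    (hC : C = LinearMap.ker (paraSyndrome π pt))
    (hC' : C' = LinearMap.ker (paraSyndrome (ρ ∘ₗ π) pt)) (h : C ≤ C')
    (B : (Fin N → ZMod 2) ⧸ C) :
    cosetGraphIso hρπ pt hC' (Submodule.factor h B) =
      ((cosetGraphIso hπ pt hC B).1, (cosetGraphIso hπ pt hC B).2.1,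
        ρ (cosetGraphIso hπ pt hC B).2.2) := by
  obtain ⟨v, rfl⟩ := Submodule.Quotient.mk_surjective C B
  exact paraSyndrome_comp π ρ pt v

/-- Under the isomorphisms with the model graphs the natural map becomes `ρ` on the `T`-coordinate.
The fibre size follows by counting, the natural map being a surjective homomorphism. -/
theorem isCover_factor (hπ : Function.Surjective π) (hρπ : Function.Surjective (ρ ∘ₗ π))
    (hC : C = LinearMap.ker (paraSyndrome π pt))
    (hC' : C' = LinearMap.ker (paraSyndrome (ρ ∘ₗ π) pt)) (h : C ≤ C') {r : ℕ} (hr : 0 < r)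
    (hcard : r * Nat.card ((Fin N → ZMod 2) ⧸ C') = Nat.card ((Fin N → ZMod 2) ⧸ C)) :
    IsCover (cosetGraph C) (cosetGraph C') (Submodule.factor h) r where
  pos := hr
  bijOn B := by
    have hb := bijOn_neighborSet_paraGraph π ρ (cosetGraphIso hπ pt hC B)
    have hf := cosetGraphIso_factor hπ hρπ hC hC' h
    rw [← hf] at hb
    have hmem : ∀ A, A ∈ (cosetGraph C).neighborSet B ↔
        cosetGraphIso hπ pt hC A ∈ (paraGraph π).neighborSet (cosetGraphIso hπ pt hC B) :=
      fun A => (cosetGraphIso hπ pt hC).map_adj_iff.symm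
    have hmem' : ∀ A, A ∈ (cosetGraph C').neighborSet (Submodule.factor h B) ↔
        cosetGraphIso hρπ pt hC' A ∈ (paraGraph (ρ ∘ₗ π)).neighborSet
          (cosetGraphIso hρπ pt hC' (Submodule.factor h B)) :=
      fun A => (cosetGraphIso hρπ pt hC').map_adj_iff.symm
    refine ⟨fun A hA => ?_, fun A hA A' hA' hAA' => ?_, fun A hA => ?_⟩
    · rw [hmem', hf A]
      exact hb.mapsTo ((hmem A).mp hA)
    · apply (cosetGraphIso hπ pt hC).injective
      refine hb.injOn ((hmem A).mp hA) ((hmem A').mp hA') ?_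
      simp only [← hf, hAA']
    · obtain ⟨p, hp, hpA⟩ := hb.surjOn ((hmem' A).mp hA)
      obtain ⟨A₀, rfl⟩ := (cosetGraphIso hπ pt hC).surjective p
      refine ⟨A₀, (hmem A₀).mpr hp, (cosetGraphIso hρπ pt hC').injective ?_⟩
      rw [hf A₀]
      exact hpA
  fibre B := by
    have hs : Function.Surjective (Submodule.factor h).toAddMonoidHom :=
      Submodule.factor_surjective h
    have := ncard_preimage_singleton_mul_card _ hs B
    rw [← hcard] at this
    have hpos : 0 < Nat.card ((Fin N → ZMod 2) ⧸ C') := Nat.card_pos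
    exact Nat.eq_of_mul_eq_mul_right hpos this

theorem dist_eq_four_of_factor_eq (hπ : Function.Surjective π)
    (hρπ : Function.Surjective (ρ ∘ₗ π)) (hC : C = LinearMap.ker (paraSyndrome π pt))
    (hC' : C' = LinearMap.ker (paraSyndrome (ρ ∘ₗ π) pt)) (h : C ≤ C')
    {A B : (Fin N → ZMod 2) ⧸ C} (hne : A ≠ B)
    (hAB : Submodule.factor h A = Submodule.factor h B) : (cosetGraph C).dist A B = 4 := by
  have hA := cosetGraphIso_factor hπ hρπ hC hC' h A
  have hB := cosetGraphIso_factor hπ hρπ hC hC' h B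
  rw [hAB, hB] at hA
  rw [← dist_iso_apply (cosetGraphIso hπ pt hC), dist_paraGraph_eq_four_iff hπ]
  exact ⟨(cosetGraphIso hπ pt hC).injective.ne hne, (congrArg Prod.fst hA).symm,
    (congrArg (fun p => p.2.1) hA).symm⟩

end Cover

end Model

section Field

/-! ### The subfield `𝔽_q` of `F` and the coordinates -/

section Coordinates

variable (F : Type*) [Field F] [Algebra (ZMod 2) F]

/-- The subfield `{x | x ^ 2 ^ u = x}`. -/
def fixedSubfield (u : ℕ) : IntermediateField (ZMod 2) F :=
  have : CharP F 2 := charP_of_injective_algebraMap (algebraMap (ZMod 2) F).injective 2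
  { carrier := {x | x ^ 2 ^ u = x}
    mul_mem' := fun {x y} (hx : x ^ 2 ^ u = x) (hy : y ^ 2 ^ u = y) =>
      show (x * y) ^ 2 ^ u = x * y by rw [mul_pow, hx, hy]
    add_mem' := fun {x y} (hx : x ^ 2 ^ u = x) (hy : y ^ 2 ^ u = y) =>
      show (x + y) ^ 2 ^ u = x + y by rw [add_pow_char_pow, hx, hy]
    algebraMap_mem' := fun a => by
      rcases zmod_two_cases a with rfl | rfl
      · simp
      · simp
    inv_mem' := fun x (hx : x ^ 2 ^ u = x) =>
      show x⁻¹ ^ 2 ^ u = x⁻¹ by rw [inv_pow, hx] }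

variable {F}

theorem mem_fixedSubfield {u : ℕ} {x : F} : x ∈ fixedSubfield F u ↔ x ^ 2 ^ u = x := Iff.rfl

/-- The linear map `(γ₁, γ₂) ↦ γ₁ + γ₂ α`. -/
def combine (u : ℕ) (α : F) :
    (fixedSubfield F u × fixedSubfield F u) →ₗ[ZMod 2] F where
  toFun z := z.1 + z.2 * α
  map_add' z w := by simp; ring
  map_smul' a z := by simp

variable {u : ℕ} {α : F}

theorem combine_bijective (hF : Nat.card F = 2 ^ (2 * u)) (hα : α ^ 2 ^ u ≠ α) :
    Function.Bijective (combine u α) := by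
  constructor
  · refine (injective_iff_map_eq_zero _).mpr ?_
    rintro ⟨a, b⟩ h
    have h' : (a : F) + b * α = 0 := h
    by_cases hb : b = 0
    · subst hb
      have : (a : F) = 0 := by simpa using h'
      exact Prod.ext (Subtype.ext this) rfl
    -- A nontrivial relation `a + b α = 0` would put `α` into the subfield.
    · exfalso
      apply hα
      have hb' : (b : F) ≠ 0 := fun h => hb (Subtype.ext h)
      have : α = -a / b := by
        field_simp
        linear_combination h'
      exact this ▸ (fixedSubfield F u).div_mem ((fixedSubfield F u).neg_mem a.2) b.2
  · intro x
    obtain ⟨h1, h2, h3⟩ := coord_spec u hF α hα x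
    exact ⟨(⟨_, h2⟩, ⟨_, h3⟩), h1⟩

/-- The coordinates `(γ₁, γ₂)` of the elements of `F`. -/
noncomputable def coords (hF : Nat.card F = 2 ^ (2 * u)) (hα : α ^ 2 ^ u ≠ α) :
    F ≃ₗ[ZMod 2] fixedSubfield F u × fixedSubfield F u :=
  (LinearEquiv.ofBijective (combine u α) (combine_bijective hF hα)).symm

variable (hF : Nat.card F = 2 ^ (2 * u)) (hα : α ^ 2 ^ u ≠ α)

theorem coords_spec (x : F) : ((coords hF hα x).1 : F) + (coords hF hα x).2 * α = x :=
  (LinearEquiv.ofBijective (combine u α) (combine_bijective hF hα)).apply_symm_apply x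

theorem coords_eq (x : F) :
    ((coords hF hα x).1 : F) = coordOne u α x ∧ ((coords hF hα x).2 : F) = coordTwo u α x := by
  obtain ⟨h1, h2, h3⟩ := coord_spec u hF α hα x
  have : coords hF hα x = (⟨_, h2⟩, ⟨_, h3⟩) := by
    refine (combine_bijective hF hα).1 ?_
    exact (coords_spec hF hα x).trans h1.symm
  rw [this]
  exact ⟨rfl, rfl⟩

theorem card_fixedSubfield_prod (hF : Nat.card F = 2 ^ (2 * u)) (hα : α ^ 2 ^ u ≠ α) :
    Nat.card (fixedSubfield F u × fixedSubfield F u) = 2 ^ (2 * u) := by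
  rw [← hF, Nat.card_congr (coords hF hα).toEquiv]

theorem card_fixedSubfield (hF : Nat.card F = 2 ^ (2 * u)) (hα : α ^ 2 ^ u ≠ α) : Nat.card (fixedSubfield F u) = 2 ^ u := by
  have h := card_fixedSubfield_prod hF hα
  rw [Nat.card_prod, two_mul, pow_add] at h
  exact Nat.mul_self_inj.mp h

end Coordinates

/-! ### Powers of a primitive element -/

/-- The exponents `2^u` and 1 are distinct and both below the order of `α`. -/
theorem pow_ne_self_of_orderOf {F : Type*} [Field F] {u : ℕ} {α : F}
    (hu : 2 ≤ u) (hα : orderOf α = 2 ^ (2 * u) - 1) :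
    α ^ 2 ^ u ≠ α := by
  intro h
  have h4 : 4 ≤ 2 ^ u := (by norm_num : 4 = 2 ^ 2).trans_le (Nat.pow_le_pow_right two_pos hu)
  have hq : 2 ^ (2 * u) = 2 ^ u * 2 ^ u := by rw [two_mul, pow_add]
  have hlt : 2 ^ u < orderOf α := by
    rw [hα, hq]
    have : 4 * 2 ^ u ≤ 2 ^ u * 2 ^ u := Nat.mul_le_mul_right _ h4
    omega
  have := pow_injOn_Iio_orderOf (x := α) (x₁ := 2 ^ u) (x₂ := 1) hlt
    (by simp only [Set.mem_Iio]; omega) (by simp only [h, pow_one])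
  omega

/-- The parity position receives the element 0, the only one that is not a power of `α`. -/
theorem bijective_cons_zero_pow {F : Type*} [Field F] {u : ℕ} {α : F}
    (hF : Nat.card F = 2 ^ (2 * u))
    (hα : orderOf α = 2 ^ (2 * u) - 1) :
    Function.Bijective
      (Fin.cons 0 (fun j => α ^ (j : ℕ)) : Fin (2 ^ (2 * u) - 1 + 1) → F) := by
  have hfin : Finite F := Nat.finite_of_card_ne_zero (by rw [hF]; positivity)
  have h0 : α ≠ 0 := by
    rintro rfl
    rw [orderOf_zero] at hα
    have := hF ▸ Finite.one_lt_card (α := F)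
    omega
  refine (Nat.bijective_iff_injective_and_card _).mpr ⟨?_, ?_⟩
  · rw [Fin.cons_injective_iff]
    refine ⟨?_, ?_⟩
    · rintro ⟨j, hj⟩
      exact pow_ne_zero _ h0 hj
    · intro j j' h
      refine Fin.ext (pow_injOn_Iio_orderOf (x := α) ?_ ?_ h)
      · rw [hα]; exact j.2
      · rw [hα]; exact j'.2
  · rw [Nat.card_fin, hF, Nat.sub_add_cancel Nat.one_le_two_pow]

/-! ### The codes -/

section Codes

variable {F : Type*} [Field F] [Algebra (ZMod 2) F] {u : ℕ} {α : F}

variable (hF : Nat.card F = 2 ^ (2 * u)) (hq : α ^ 2 ^ u ≠ α)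

/-- `S(v)` as an element of the subfield. -/
noncomputable def syndromeK :
    (Fin (2 ^ (2 * u) - 1) → ZMod 2) →ₗ[ZMod 2] fixedSubfield F u :=
  Fintype.linearCombination (ZMod 2)
    (fun j => (coords hF hq (α ^ (j : ℕ))).1 * (coords hF hq (α ^ (j : ℕ))).2)

theorem coe_syndromeK (v : Fin (2 ^ (2 * u) - 1) → ZMod 2) :
    (syndromeK hF hq v : F) = syndromeS u α v := by
  change (fixedSubfield F u).val.toLinearMap (syndromeK hF hq v) = _
  simp only [syndromeK, syndromeS, Fintype.linearCombination_apply, ← coords_eq hF hq, map_sum,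
    map_smul]
  rfl

theorem sum_smul_sq_eq_zero {ι : Type*} [Fintype ι] (v : ι → ZMod 2) (a : ι → F)
    (h : ∑ j, v j • a j = 0) : ∑ j, v j • a j ^ 2 = 0 := by
  have : CharP F 2 := charP_of_injective_algebraMap (algebraMap (ZMod 2) F).injective 2
  have hv : ∀ c : ZMod 2, c ^ 2 = c := by decide
  calc ∑ j, v j • a j ^ 2 = ∑ j, (v j • a j) ^ 2 :=
        Finset.sum_congr rfl fun j _ => by rw [smul_pow, hv]
    _ = (∑ j, v j • a j) ^ 2 := (CharTwo.sum_sq _ _).symm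
    _ = 0 := by rw [h, zero_pow two_ne_zero]

/-- The `2^u`-th power fixes both coordinates, so this is the norm form in the basis `1, α`; its
mixed coefficient is the trace of `α`. -/
theorem pow_norm_eq (x : F) :
    x ^ (2 ^ u + 1) = ((coords hF hq x).1 : F) ^ 2 +
      (α + α ^ 2 ^ u) * (((coords hF hq x).1 : F) * (coords hF hq x).2) +
      ((coords hF hq x).2 : F) ^ 2 * α ^ (2 ^ u + 1) := by
  have : CharP F 2 := charP_of_injective_algebraMap (algebraMap (ZMod 2) F).injective 2
  have h1 := mem_fixedSubfield.mp (coords hF hq x).1.2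
  have h2 := mem_fixedSubfield.mp (coords hF hq x).2.2
  nth_rewrite 1 [← coords_spec hF hq x]
  rw [pow_succ, add_pow_char_pow, mul_pow, h1, h2]
  ring

/-- On the Hamming code the syndromes `E` and `S` are proportional. -/
theorem syndromeE_eq (hF : Nat.card F = 2 ^ (2 * u)) (hq : α ^ 2 ^ u ≠ α)
    (v : Fin (2 ^ (2 * u) - 1) → ZMod 2) (hv : syndromeH u α v = 0) :
    syndromeE u α v = (α + α ^ 2 ^ u) * syndromeS u α v := by
  have h0 : ∑ j, v j • coords hF hq (α ^ (j : ℕ)) = 0 := by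
    simp only [← map_smul, ← map_sum]
    rw [← map_zero (coords hF hq), ← hv, syndromeH, Fintype.linearCombination_apply]
  have h1 : ∑ j, v j • ((coords hF hq (α ^ (j : ℕ))).1 : F) = 0 := by
    have := congrArg ((fixedSubfield F u).val.toLinearMap ∘ₗ LinearMap.fst (ZMod 2) _ _) h0
    simp only [map_sum, map_smul, map_zero] at this
    exact this
  have h2 : ∑ j, v j • ((coords hF hq (α ^ (j : ℕ))).2 : F) = 0 := by
    have := congrArg ((fixedSubfield F u).val.toLinearMap ∘ₗ LinearMap.snd (ZMod 2) _ _) h0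
    simp only [map_sum, map_smul, map_zero] at this
    exact this
  have hterm : ∀ j : Fin (2 ^ (2 * u) - 1), v j • α ^ ((j : ℕ) * (2 ^ u + 1)) =
      v j • ((coords hF hq (α ^ (j : ℕ))).1 : F) ^ 2 + (α + α ^ 2 ^ u) *
        (v j • (coordOne u α (α ^ (j : ℕ)) * coordTwo u α (α ^ (j : ℕ)))) +
      (v j • ((coords hF hq (α ^ (j : ℕ))).2 : F) ^ 2) * α ^ (2 ^ u + 1) := fun j => by
    rw [pow_mul, pow_norm_eq hF hq, smul_add, smul_add, mul_smul_comm, smul_mul_assoc,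
      (coords_eq hF hq _).1, (coords_eq hF hq _).2]
  -- Both sums of squares vanish because the coordinate sums `h1` and `h2` do; only the mixed term
  -- survives.
  rw [syndromeE, syndromeS, Fintype.linearCombination_apply, Fintype.linearCombination_apply,
    Finset.sum_congr rfl fun j _ => hterm j, Finset.sum_add_distrib, Finset.sum_add_distrib,
    ← Finset.sum_mul, sum_smul_sq_eq_zero _ _ h1, sum_smul_sq_eq_zero _ _ h2, zero_mul, zero_add,
    add_zero, Finset.mul_sum]

/-- The trace `α + α^(2^u)` is nonzero as `α` is outside the subfield, so `S` may replace `E`. -/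
theorem mem_baseCode (v : Fin (2 ^ (2 * u) - 1) → ZMod 2) :
    v ∈ baseCode u α ↔ syndromeH u α v = 0 ∧ syndromeK hF hq v = 0 := by
  rw [baseCode, Submodule.mem_inf, LinearMap.mem_ker, LinearMap.mem_ker]
  refine and_congr_right fun h => ?_
  have hne : α + α ^ 2 ^ u ≠ 0 := by
    rw [Ne, add_eq_zero_iff_eq_of_zmod]
    exact hq.symm
  rw [syndromeE_eq hF hq v h, mul_eq_zero, or_iff_right hne, ← coe_syndromeK hF hq,
    ZeroMemClass.coe_eq_zero]

theorem mem_nestedCode {v : Fin u → (Fin (2 ^ (2 * u) - 1) → ZMod 2)}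
    (hv : ∀ k, v k ∈ hammingCode u α) (i : ℕ) (x : Fin (2 ^ (2 * u) - 1) → ZMod 2) :
    x ∈ nestedCode u α v i ↔ syndromeH u α x = 0 ∧
      syndromeK hF hq x ∈ Submodule.span (ZMod 2)
        ((fun k => syndromeK hF hq (v k)) '' {k : Fin u | (k : ℕ) + i < u}) := by
  have himage : (fun k => syndromeK hF hq (v k)) '' {k : Fin u | (k : ℕ) + i < u} =
      syndromeK hF hq '' (v '' {k : Fin u | (k : ℕ) + i < u}) := by
    rw [Set.image_image]
  have hspan : Submodule.span (ZMod 2) (v '' {k : Fin u | (k : ℕ) + i < u}) ≤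
      LinearMap.ker (syndromeH u α) := by
    rw [Submodule.span_le]
    rintro _ ⟨k, -, rfl⟩
    exact hv k
  rw [himage, ← Submodule.map_span, nestedCode]
  constructor
  · intro hx
    obtain ⟨b, hb, w, hw, rfl⟩ := Submodule.mem_sup.mp hx
    obtain ⟨hb1, hb2⟩ := (mem_baseCode hF hq b).mp hb
    rw [map_add, map_add, hb1, hb2, zero_add, zero_add]
    exact ⟨hspan hw, Submodule.mem_map_of_mem hw⟩
  · rintro ⟨hx, w, hw, hwx⟩
    -- Subtracting a combination `w` of the `v k` with the same `S`-value leaves a word of the base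
    -- code.
    refine Submodule.mem_sup.mpr ⟨x - w, ?_, w, hw, sub_add_cancel x w⟩
    rw [mem_baseCode hF hq, map_sub, map_sub, hx, hwx, sub_self, zero_sub, neg_eq_zero]
    exact ⟨hspan hw, rfl⟩

/-! ### The syndromes of the extended codes -/

/-- The points of `K²` in the order of the coordinate positions of the extended codes. -/
noncomputable def codePoints (hα : orderOf α = 2 ^ (2 * u) - 1) :
    Fin (2 ^ (2 * u) - 1 + 1) ≃ fixedSubfield F u × fixedSubfield F u :=
  (Equiv.ofBijective _ (bijective_cons_zero_pow hF hα)).trans (coords hF hq).toEquiv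

theorem codePoints_zero (hα : orderOf α = 2 ^ (2 * u) - 1) : codePoints hF hq hα 0 = 0 :=
  map_zero (coords hF hq)

theorem codePoints_succ (hα : orderOf α = 2 ^ (2 * u) - 1) (j : Fin (2 ^ (2 * u) - 1)) :
    codePoints hF hq hα j.succ = coords hF hq (α ^ (j : ℕ)) := rfl

theorem paraSyndrome_codePoints (hα : orderOf α = 2 ^ (2 * u) - 1) {T : Type*} [AddCommGroup T]
    [Module (ZMod 2) T] (π : fixedSubfield F u →ₗ[ZMod 2] T)
    (y : Fin (2 ^ (2 * u) - 1 + 1) → ZMod 2) :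
    paraSyndrome π (codePoints hF hq hα) y =
      (y 0 + ∑ j : Fin (2 ^ (2 * u) - 1), y j.succ,
        coords hF hq (syndromeH u α fun j => y j.succ),
        π (syndromeK hF hq fun j => y j.succ)) := by
  simp only [paraSyndrome, Fintype.linearCombination_apply, Fin.sum_univ_succ, codePoints_zero,
    codePoints_succ, paraPoint, syndromeH, syndromeK, map_sum, map_smul]
  refine Prod.ext ?_ (Prod.ext ?_ ?_) <;> simp [Prod.fst_sum, Prod.snd_sum]

/-- The span of `S(v_1), …, S(v_{u-i})`. -/
noncomputable def syndromeSpan (v : Fin u → (Fin (2 ^ (2 * u) - 1) → ZMod 2)) (i : ℕ) :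
    Submodule (ZMod 2) (fixedSubfield F u) :=
  Submodule.span (ZMod 2)
    ((fun k => syndromeK hF hq (v k)) '' {k : Fin u | (k : ℕ) + i < u})

/-- Adjoining the `v k` relaxes `S = 0` to `S` vanishing modulo their `S`-values, which is the third
syndrome component; the first is the overall parity check. -/
theorem nestedCodeStar_eq_ker (hα : orderOf α = 2 ^ (2 * u) - 1)
    {v : Fin u → (Fin (2 ^ (2 * u) - 1) → ZMod 2)} (hv : ∀ k, v k ∈ hammingCode u α) (i : ℕ) :
    nestedCodeStar u α v i =
      LinearMap.ker (paraSyndrome (syndromeSpan hF hq v i).mkQ (codePoints hF hq hα)) := by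
  ext y
  rw [LinearMap.mem_ker, paraSyndrome_codePoints]
  change (fun j : Fin (2 ^ (2 * u) - 1) => y j.succ) ∈ nestedCode u α v i ∧ _ ↔ _
  rw [mem_nestedCode hF hq hv, Prod.mk_eq_zero, Prod.mk_eq_zero, add_eq_zero_iff_eq_of_zmod,
    map_eq_zero_iff _ (coords hF hq).injective, Submodule.mkQ_apply,
    Submodule.Quotient.mk_eq_zero, and_comm]
  rfl

theorem exists_isGeneratingFamily (hF : Nat.card F = 2 ^ (2 * u)) (hq : α ^ 2 ^ u ≠ α)
    (hα : orderOf α = 2 ^ (2 * u) - 1) :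
    ∃ v, IsGeneratingFamily u α v := by
  have hfin : Finite F := Nat.finite_of_card_ne_zero (by rw [hF]; positivity)
  have hdim : Module.finrank (ZMod 2) (fixedSubfield F u) = u := by
    have h := card_fixedSubfield hF hq
    rw [Module.natCard_eq_pow_finrank (K := ZMod 2), Nat.card_zmod] at h
    exact Nat.pow_right_injective le_rfl h
  let b := Module.finBasisOfFinrankEq (ZMod 2) (fixedSubfield F u) hdim
  have hex : ∀ k : fixedSubfield F u, ∃ v, syndromeH u α v = 0 ∧ syndromeK hF hq v = k := by
    intro k
    -- With `π` the identity, surjectivity yields Hamming words with any prescribed `S`-value, in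
    -- particular a basis of the subfield.
    obtain ⟨y, hy⟩ := paraSyndrome_surjective (π := LinearMap.id) Function.surjective_id
      (codePoints hF hq hα) (0, 0, k)
    rw [paraSyndrome_codePoints, Prod.mk.injEq, Prod.mk.injEq] at hy
    exact ⟨_, (map_eq_zero_iff _ (coords hF hq).injective).mp hy.2.1, hy.2.2⟩
  choose w hw1 hw2 using hex
  refine ⟨fun k => w (b k), fun k => hw1 (b k), ?_⟩
  have := b.linearIndependent.map' (fixedSubfield F u).val.toLinearMap
    (LinearMap.ker_eq_bot.mpr Subtype.val_injective)
  have heq : (fun k => syndromeS u α (w (b k))) =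
      (fixedSubfield F u).val.toLinearMap ∘ b := funext fun k => by
    rw [← coe_syndromeK hF hq, hw2]
    rfl
  exact heq ▸ this

theorem card_quotient_syndromeSpan {v : Fin u → (Fin (2 ^ (2 * u) - 1) → ZMod 2)}
    (hv : LinearIndependent (ZMod 2) fun k => syndromeS u α (v k)) {i : ℕ} (hi : i ≤ u) :
    Nat.card (fixedSubfield F u ⧸ syndromeSpan hF hq v i) = 2 ^ i := by
  have hfin : Finite F := Nat.finite_of_card_ne_zero (by rw [hF]; positivity)
  have hli : LinearIndependent (ZMod 2) fun k => syndromeK hF hq (v k) := by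
    apply LinearIndependent.of_comp (fixedSubfield F u).val.toLinearMap
    have heq : (fixedSubfield F u).val.toLinearMap ∘ (fun k => syndromeK hF hq (v k)) =
        fun k => syndromeS u α (v k) := funext fun k => coe_syndromeK hF hq (v k)
    exact heq ▸ hv
  have hset : {k : Fin u | (k : ℕ) + i < u} = Set.range (Fin.castLE (Nat.sub_le u i)) := by
    ext k
    constructor
    · intro hk
      have hk' : (k : ℕ) + i < u := hk
      exact ⟨⟨k, by omega⟩, rfl⟩
    · rintro ⟨l, rfl⟩
      change (l : ℕ) + i < u
      omega
  have hW : Nat.card (syndromeSpan hF hq v i) = 2 ^ (u - i) := by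
    rw [Module.natCard_eq_pow_finrank (K := ZMod 2), Nat.card_zmod, syndromeSpan, hset,
      ← Set.range_comp, finrank_span_eq_card
        (hli.comp _ (Fin.castLE_injective (Nat.sub_le u i))), Fintype.card_fin]
  have h := Submodule.card_eq_card_quotient_mul_card (syndromeSpan hF hq v i)
  rw [hW, card_fixedSubfield hF hq] at h
  have h2 : 2 ^ u = 2 ^ i * 2 ^ (u - i) := by rw [← pow_add, Nat.add_sub_cancel' hi]
  rw [h2, mul_comm] at h
  exact (Nat.eq_of_mul_eq_mul_left (by positivity) h).symm

theorem syndromeSpan_anti (v : Fin u → (Fin (2 ^ (2 * u) - 1) → ZMod 2)) {i j : ℕ}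
    (hij : j ≤ i) : syndromeSpan hF hq v i ≤ syndromeSpan hF hq v j := by
  refine Submodule.span_mono (Set.image_mono fun k hk => ?_)
  have hk' : (k : ℕ) + i < u := hk
  change (k : ℕ) + j < u
  omega

end Codes

end Field

end CosetGraphs

/-! ### Assembly: the model with `T` the quotient of the subfield by `syndromeSpan` -/

theorem mainTheorem4 {F : Type*} [Field F] [Algebra (ZMod 2) F] (u : ℕ) (hu : 2 ≤ u)
    (hF : Nat.card F = 2 ^ (2 * u)) (α : F) (hα : orderOf α = 2 ^ (2 * u) - 1) :
    (∃ v : Fin u → (Fin (2 ^ (2 * u) - 1) → ZMod 2), CosetGraphs.IsGeneratingFamily u α v) ∧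
    ∀ v : Fin u → (Fin (2 ^ (2 * u) - 1) → ZMod 2), CosetGraphs.IsGeneratingFamily u α v →
      -- number of vertices
      (∀ i ≤ u, Nat.card ((Fin (2 ^ (2 * u) - 1 + 1) → ZMod 2) ⧸
          CosetGraphs.nestedCodeStar u α v i) = 2 ^ (2 * u + i + 1)) ∧
      -- antipodality, diameter and intersection array for `1 ≤ i ≤ u`
      (∀ i, 1 ≤ i → i ≤ u →
        CosetGraphs.IsAntipodal (CosetGraphs.GammaStar u α v i) ∧
        (CosetGraphs.GammaStar u α v i).diam = 4 ∧
        CosetGraphs.IsDistanceRegular (CosetGraphs.GammaStar u α v i)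
          [2 ^ (2 * u), 2 ^ (2 * u) - 1, 2 ^ (2 * u) - 2 ^ (2 * u - i), 1]
          [1, 2 ^ (2 * u - i), 2 ^ (2 * u) - 1, 2 ^ (2 * u)]) ∧
      -- the degenerate graph `i = 0`
      (Nonempty (CosetGraphs.GammaStar u α v 0 ≃g
          completeBipartiteGraph (Fin (2 ^ (2 * u))) (Fin (2 ^ (2 * u)))) ∧
        CosetGraphs.IsDistanceRegular (CosetGraphs.GammaStar u α v 0)
          [2 ^ (2 * u), 2 ^ (2 * u) - 1] [1, 2 ^ (2 * u)]) ∧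
      -- the codes are nested, and the natural maps between the coset graphs are coverings whose
      -- fibres consist of vertices at mutual distance 4
      (∀ i j, j < i → i ≤ u →
        CosetGraphs.nestedCodeStar u α v i < CosetGraphs.nestedCodeStar u α v j ∧
        ∃ h : CosetGraphs.nestedCodeStar u α v i ≤ CosetGraphs.nestedCodeStar u α v j,
          CosetGraphs.IsCover (CosetGraphs.GammaStar u α v i) (CosetGraphs.GammaStar u α v j)
            (Submodule.factor h) (2 ^ (i - j)) ∧
          ∀ x y, x ≠ y → Submodule.factor h x = Submodule.factor h y →
            (CosetGraphs.GammaStar u α v i).dist x y = 4) ∧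
      -- distance-transitivity
      (∀ i ≤ u, (i = 0 ∨ i = 1 ∨ i = u ∨ (2 * u = 6 ∧ i ≤ 3)) →
        CosetGraphs.IsDistanceTransitive (CosetGraphs.GammaStar u α v i)) := by
  have hq := CosetGraphs.pow_ne_self_of_orderOf hu hα
  refine ⟨CosetGraphs.exists_isGeneratingFamily hF hq hα, fun v hv => ?_⟩
  have hfin : Finite F := Nat.finite_of_card_ne_zero (by rw [hF]; positivity)
  let W := CosetGraphs.syndromeSpan hF hq v
  have hπ : ∀ i, Function.Surjective (W i).mkQ := fun i => Submodule.mkQ_surjective _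
  have hC := CosetGraphs.nestedCodeStar_eq_ker hF hq hα hv.mem_hamming
  have hT : ∀ i ≤ u, Nat.card (_ ⧸ W i) = 2 ^ i :=
    fun i hi => CosetGraphs.card_quotient_syndromeSpan hF hq hv.linearIndependent hi
  have hK := CosetGraphs.card_fixedSubfield_prod hF hq
  have hcard : ∀ i ≤ u, Nat.card ((Fin (2 ^ (2 * u) - 1 + 1) → ZMod 2) ⧸
      CosetGraphs.nestedCodeStar u α v i) = 2 ^ (2 * u + i + 1) := fun i hi => by
    rw [CosetGraphs.card_coset (hπ i) _ (hC i), hT i hi, Nat.sub_add_cancel Nat.one_le_two_pow,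
      pow_succ, pow_add]
    ring
  have hfinT : ∀ i, Finite (_ ⧸ W i) := fun i => Finite.of_surjective _ (hπ i)
  have hnt : ∀ i, 1 ≤ i → i ≤ u → Nontrivial (_ ⧸ W i) := fun i h1 hi => by
    rw [← Finite.one_lt_card_iff_nontrivial, hT i hi]
    exact Nat.one_lt_two_pow (by omega)
  have h0 : Subsingleton (_ ⧸ W 0) := (Nat.card_eq_one_iff_unique.mp (hT 0 (Nat.zero_le u))).1
  refine ⟨hcard, fun i h1 hi => ?_, ⟨?_, ?_⟩, fun i j hji hi => ?_, fun i hi hcases => ?_⟩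
  · have := hnt i h1 hi
    let φ := CosetGraphs.cosetGraphIso (hπ i) _ (hC i)
    refine ⟨(CosetGraphs.isAntipodal_paraGraph (hπ i)).of_iso φ,
      (CosetGraphs.diam_eq_of_iso φ).trans (CosetGraphs.diam_paraGraph (hπ i)), ?_⟩
    have h := (CosetGraphs.isDistanceRegular_paraGraph (hπ i) (c := 2 ^ (2 * u - i)) (by
      rw [hT i hi, hK, ← pow_add, Nat.sub_add_cancel (by omega)])).of_iso φ
    rwa [hK] at h
  · obtain ⟨ψ⟩ := CosetGraphs.nonempty_iso_completeBipartiteGraph (W 0).mkQ hK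
    exact ⟨(CosetGraphs.cosetGraphIso (hπ 0) _ (hC 0)).trans ψ⟩
  · have h := (CosetGraphs.isDistanceRegular_paraGraph_of_subsingleton (hπ 0)).of_iso
      (CosetGraphs.cosetGraphIso (hπ 0) _ (hC 0))
    rwa [hK] at h
  · have hW : W i ≤ W j := CosetGraphs.syndromeSpan_anti hF hq v hji.le
    have hcomp : Submodule.factor hW ∘ₗ (W i).mkQ = (W j).mkQ := Submodule.factor_comp_mk hW
    have hC' : CosetGraphs.nestedCodeStar u α v j = LinearMap.ker (CosetGraphs.paraSyndrome
        (Submodule.factor hW ∘ₗ (W i).mkQ) (CosetGraphs.codePoints hF hq hα)) := by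
      rw [hcomp]
      exact hC j
    have hsurj : Function.Surjective (Submodule.factor hW ∘ₗ (W i).mkQ) := by
      rw [hcomp]
      exact hπ j
    have hle : CosetGraphs.nestedCodeStar u α v i ≤ CosetGraphs.nestedCodeStar u α v j := by
      rw [hC i, hC']
      intro y hy
      rw [LinearMap.mem_ker] at hy ⊢
      rw [CosetGraphs.paraSyndrome_comp, hy]
      simp
    refine ⟨lt_of_le_of_ne hle fun heq => ?_, hle, ?_, fun x y hne hxy => ?_⟩
    -- Equal codes would have equally many cosets, forcing `i = j`.
    · have h1 := hcard i hi
      rw [heq, hcard j (by omega)] at h1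
      have := Nat.pow_right_injective le_rfl h1
      omega
    · refine CosetGraphs.isCover_factor (hπ i) hsurj (hC i) hC' hle (by positivity) ?_
      rw [hcard i hi, hcard j (by omega), ← pow_add]
      congr 1
      omega
    · exact CosetGraphs.dist_eq_four_of_factor_eq (hπ i) hsurj (hC i) hC' hle hne hxy
  · refine (CosetGraphs.isDistanceTransitive_paraGraph (hπ i) fun t t' ht ht' => ?_).of_iso
      (CosetGraphs.cosetGraphIso (hπ i) _ (hC i))
    have hKu := CosetGraphs.card_fixedSubfield hF hq
    by_cases hi0 : i = 0
    · subst hi0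
      exact absurd (Subsingleton.elim _ _) ht
    by_cases hi1 : i = 1
    · exact CosetGraphs.twistable_of_card_two _ (by rw [hT i hi, hi1, pow_one]) ht ht'
    by_cases hiu : i = u
    · refine CosetGraphs.twistable_of_injective ?_ ht ht'
      refine (Nat.bijective_iff_surjective_and_card _).mpr ⟨hπ i, ?_⟩
      rw [hT i hi, hKu, hiu]
    -- Only `2 * u = 6` with `i = 2` is left, so the subfield has 8 elements and `T` has 4.
    · have hi2 : i = 2 := by omega
      have hu3 : u = 3 := by omega
      refine CosetGraphs.twistable_of_card_eight (hπ i) ?_ ?_ ht ht'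
      · rw [hKu, hu3]
        norm_num
      · rw [hT i hi, hi2]
        norm_num
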